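/- Let $r^2=x_1^2+x_2^2$ on $\mathbb R^3$ and $E_3=(0,0,1)$. For a smooth immersion $x:M\to\mathbb R^3$ of a compact surface (possibly with boundary), oriented by a smooth unit normal field $N$, let $dM$ be the area element, $\Delta$ the Laplacian of the induced metric, $\sigma$ the second fundamental form, $H=\frac12\operatorname{tr}\sigma$ the mean curvature with respect to $N$, $h=\langle N,x\rangle$, $x_3=\langle x,E_3\rangle$ and $N_3=\langle N,E_3\rangle$. For $a,b\in\mathbb R$ define the energy $$E(x)=\int_M 1\,dM+a\int_M r^2x_3N_3\,dM+b\int_M x_3N_3\,dM .$$ The oriented immersed surface $M$ is a *stationary rotating surface* if $2H=ar^2+b$ on $M$, and it is then *strongly stable* if $$-\int_M f\Big(\Delta f+\big(|\sigma|^2-2a(h-x_3N_3)\big)f\Big)\,dM\ \ge 0$$ for every smooth function $f$ on $M$ that vanishes on $\partial M$. **Theorem.** Let $\Omega\subset\mathbb R^2$ be a domain (open and connected), and let $M$ be a compact stationary rotating surface, with $2H=ar^2+b$, that is the graph over $\overline\Omega$ of a function $u$ which is smooth on an open neighbourhood of $\overline\Omega$; that is, $x$ is injective, the interior of $M$ is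 mapped onto the graph of $u$ over $\Omega$, and $\partial M$ onto the graph of $u$ over $\partial\Omega$. Then: 1. $M$ is strongly stable. 2. Let $y:M'\to\mathbb R^3$ be a smooth immersion of a compact surface $M'$ oriented by a unit normal field $N'$, with the same boundary as $M$ ($y$ is injective on $\partial M'$ and $y(\partial M')=x(\partial M)$), such that $M\cup M'$ bounds an oriented 3-chain: there is a smooth singular (cubical) 3-chain $W$ in $\mathbb R^3$ with integer coefficients such that $\partial W=M-M'$, meaning that every smooth 2-form on $\mathbb R^3$ has the same integral over the sum $\partial W$ of the oriented faces of $W$ as over $M-M'$. If $y(M')\subset\overline\Omega\times\mathbb R$, then $E(x)\le E(y)$, where both energies are taken with the constants $a,b$ of $M$. -/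

import Mathlib

open scoped Manifold ContDiff
open MeasureTheory

namespace RotatingSurface

/-- The horizontal plane `ℝ²`. -/
abbrev Plane : Type := EuclideanSpace ℝ (Fin 2)

/-- Euclidean three-space; the axis of rotation is the third coordinate axis. -/
abbrev Space : Type := EuclideanSpace ℝ (Fin 3)

/-- The vertical projection of `ℝ³` onto `ℝ²`. -/
noncomputable def horizontal (q : Space) : Plane := !₂[q 0, q 1]

section Surface

/- A compact surface (with or without boundary) is a compact Hausdorff smooth manifold `M` modelled
on the Euclidean half-plane. The maps `x : M → ℝ³` below are immersions of `M`, and `N : M → ℝ³` is a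
unit normal field along `x`; the choice of `N` is the choice of the orientation. -/

variable {M : Type*} [TopologicalSpace M] [ChartedSpace (EuclideanHalfSpace 2) M]

/-- The derivative `∂ᵢV` at `p` of an `ℝ³`-valued map on the surface: the differential applied to
the `i`-th coordinate vector of the preferred chart at `p`. -/
noncomputable def vecDeriv (V : M → Space) (p : M) (i : Fin 2) : Space :=
  (show Plane →L[ℝ] Space from mfderiv (𝓡∂ 2) 𝓘(ℝ, Space) V p) (EuclideanSpace.single i 1)

/-- The derivative `∂ᵢf` at `p` of a real function on the surface. -/
noncomputable def funDeriv (f : M → ℝ) (p : M) (i : Fin 2) : ℝ :=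
  (show Plane →L[ℝ] ℝ from mfderiv (𝓡∂ 2) 𝓘(ℝ, ℝ) f p) (EuclideanSpace.single i 1)

/-- `x` is a smooth immersion and `N` is a smooth unit normal field (Gauss map) along it. -/
structure IsOrientedImmersion (x N : M → Space) : Prop where
  smooth : ContMDiff (𝓡∂ 2) 𝓘(ℝ, Space) ∞ x
  immersion : ∀ p, Function.Injective (mfderiv (𝓡∂ 2) 𝓘(ℝ, Space) x p)
  smooth_normal : ContMDiff (𝓡∂ 2) 𝓘(ℝ, Space) ∞ N
  norm_normal : ∀ p, ‖N p‖ = 1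
  normal : ∀ p i, inner ℝ (N p) (vecDeriv x p i) = 0

/-- The first fundamental form `gᵢⱼ = ⟨∂ᵢx, ∂ⱼx⟩`. -/
noncomputable def firstForm (x : M → Space) (p : M) : Matrix (Fin 2) (Fin 2) ℝ :=
  Matrix.of fun i j => inner ℝ (vecDeriv x p i) (vecDeriv x p j)

/-- The second fundamental form `σᵢⱼ = -⟨∂ᵢN, ∂ⱼx⟩`. -/
noncomputable def secondForm (x N : M → Space) (p : M) : Matrix (Fin 2) (Fin 2) ℝ :=
  Matrix.of fun i j => -inner ℝ (vecDeriv N p i) (vecDeriv x p j)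

/-- The matrix `g⁻¹σ` of the Weingarten map. -/
noncomputable def weingarten (x N : M → Space) (p : M) : Matrix (Fin 2) (Fin 2) ℝ :=
  (firstForm x p)⁻¹ * secondForm x N p

/-- The mean curvature `H` (half the trace of the Weingarten map). -/
noncomputable def meanCurvature (x N : M → Space) (p : M) : ℝ :=
  (weingarten x N p).trace / 2

/-- The squared norm `|σ|²` of the second fundamental form. -/
noncomputable def normSqSecondForm (x N : M → Space) (p : M) : ℝ :=
  (weingarten x N p * weingarten x N p).trace

/-- The gradient `∇f = gⁱʲ ∂ᵢf ∂ⱼx` in the induced metric, as a vector of `ℝ³` tangent to the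
surface. -/
noncomputable def surfaceGradient (x : M → Space) (f : M → ℝ) (p : M) : Space :=
  ∑ i, ∑ j, ((firstForm x p)⁻¹ i j * funDeriv f p i) • vecDeriv x p j

/-- The divergence `gⁱʲ ⟨∂ᵢV, ∂ⱼx⟩` along the surface of an `ℝ³`-valued map `V`; for tangent `V`
this is the divergence in the induced metric. -/
noncomputable def surfaceDivergence (x V : M → Space) (p : M) : ℝ :=
  ∑ i, ∑ j, (firstForm x p)⁻¹ i j * inner ℝ (vecDeriv V p i) (vecDeriv x p j)

/-- The Laplacian `Δf = div ∇f` of the induced metric. -/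
noncomputable def laplacian (x : M → Space) (f : M → ℝ) (p : M) : ℝ :=
  surfaceDivergence x (surfaceGradient x f) p

/-- The Gram matrix of the local parametrization of `x` given by the preferred chart at `p`, at the
point `z` of the target of this chart. -/
noncomputable def chartGram (x : M → Space) (p : M) (z : Plane) : Matrix (Fin 2) (Fin 2) ℝ :=
  Matrix.of fun i j =>
    inner ℝ
      (fderivWithin ℝ (x ∘ (extChartAt (𝓡∂ 2) p).symm) (Set.range (𝓡∂ 2)) z
        (EuclideanSpace.single i 1))
      (fderivWithin ℝ (x ∘ (extChartAt (𝓡∂ 2) p).symm) (Set.range (𝓡∂ 2)) z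
        (EuclideanSpace.single j 1))

/-- The area measure `√(det g) dz` on the source of the preferred chart at `p`, extended by zero to
the surface. -/
noncomputable def chartArea [MeasurableSpace M] (x : M → Space) (p : M) : Measure M :=
  ((volume.restrict (extChartAt (𝓡∂ 2) p).target).withDensity
    fun z => ENNReal.ofReal (Real.sqrt (chartGram x p z).det)).map (extChartAt (𝓡∂ 2) p).symm

/-- The area measure `dM` of the immersed surface: the least measure that dominates the area
measures of all charts. As these agree on overlaps, it restricts to each of them on the source of
the corresponding chart. -/
noncomputable def areaMeasure [MeasurableSpace M] (x : M → Space) : Measure M :=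
  ⨆ p : M, chartArea x p

/-- The squared distance `r² = x₁² + x₂²` to the axis of rotation. -/
noncomputable def radiusSq (q : Space) : ℝ := q 0 ^ 2 + q 1 ^ 2

/-- A stationary rotating surface: an oriented immersed surface with `2H = a r² + b`. -/
def IsStationaryRotating (a b : ℝ) (x N : M → Space) : Prop :=
  IsOrientedImmersion x N ∧ ∀ p, 2 * meanCurvature x N p = a * radiusSq (x p) + b

/-- The energy `∫ 1 dM + a ∫ r² x₃ N₃ dM + b ∫ x₃ N₃ dM`. -/
noncomputable def energy [MeasurableSpace M] (a b : ℝ) (x N : M → Space) : ℝ :=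
  (∫ _p, (1 : ℝ) ∂(areaMeasure x))
    + a * (∫ p, radiusSq (x p) * x p 2 * N p 2 ∂(areaMeasure x))
    + b * (∫ p, x p 2 * N p 2 ∂(areaMeasure x))

/-- The operator `L[f] = Δf + (|σ|² - 2a(h - x₃ N₃)) f`, with `h = ⟨N, x⟩` the support function. -/
noncomputable def jacobiOperator (a : ℝ) (x N : M → Space) (f : M → ℝ) (p : M) : ℝ :=
  laplacian x f p
    + (normSqSecondForm x N p - 2 * a * (inner ℝ (N p) (x p) - x p 2 * N p 2)) * f p

/-- Strong stability: `-∫ f L[f] dM ≥ 0` for all smooth `f` on the surface that vanish on its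
boundary (in particular for those with compact support in the interior). -/
def IsStronglyStable [MeasurableSpace M] (a : ℝ) (x N : M → Space) : Prop :=
  ∀ f : M → ℝ, ContMDiff (𝓡∂ 2) 𝓘(ℝ, ℝ) ∞ f → (∀ p ∈ (𝓡∂ 2).boundary M, f p = 0) →
    0 ≤ -∫ p, f p * jacobiOperator a x N f p ∂(areaMeasure x)

/-- The surface is the graph of a function `u`, smooth up to the boundary, over the closure of `Ω`:
the interior of the surface is the part over `Ω`, its boundary is the part over the boundary
of `Ω`. -/
def IsGraphOver (Ω : Set Plane) (x : M → Space) : Prop :=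
  Function.Injective x ∧
    ∃ (u : Plane → ℝ) (U : Set Plane), IsOpen U ∧ closure Ω ⊆ U ∧ ContDiffOn ℝ ∞ u U ∧
      x '' (𝓡∂ 2).interior M = (fun q : Plane => (!₂[q 0, q 1, u q] : Space)) '' Ω ∧
      x '' (𝓡∂ 2).boundary M = (fun q : Plane => (!₂[q 0, q 1, u q] : Space)) '' frontier Ω

/-- The flux `∫ ⟨Z, N⟩ dM` through the oriented surface, that is, the integral over it of the
2-form that corresponds to the vector field `Z`. -/
noncomputable def surfaceFlux [MeasurableSpace M] (x N : M → Space) (Z : Space → Space) : ℝ :=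
  ∫ p, inner ℝ (Z (x p)) (N p) ∂(areaMeasure x)

end Surface

section Chains

/-- Smooth singular `n`-cubes in `ℝ³`; only the values on `[0,1]ⁿ` matter. -/
def SmoothCube (n : ℕ) : Type := {c : (Fin n → ℝ) → Space // ContDiff ℝ ∞ c}

/-- Smooth singular cubical `n`-chains with integer coefficients. -/
abbrev CubeChain (n : ℕ) : Type := SmoothCube n →₀ ℤ

theorem contDiff_insertNth {n : ℕ} (i : Fin (n + 1)) (s : ℝ) :
    ContDiff ℝ ∞ fun t : Fin n → ℝ => (i.insertNth s t : Fin (n + 1) → ℝ) := by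
  rw [contDiff_pi]
  intro j
  refine Fin.succAboveCases i ?_ (fun k => ?_) j
  · simpa using contDiff_const
  · simpa using contDiff_apply ℝ ℝ k

/-- The face of a cube on which the `i`-th coordinate equals `ε ∈ {0, 1}`. -/
def SmoothCube.face {n : ℕ} (c : SmoothCube (n + 1)) (i : Fin (n + 1)) (ε : Fin 2) :
    SmoothCube n :=
  ⟨fun t => c.1 (i.insertNth ((ε : ℕ) : ℝ) t), c.2.comp (contDiff_insertNth i _)⟩

/-- The boundary of a chain: the sum of the faces with sign `(-1)^(i+ε)`, where the coordinates are
counted from `1`. -/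
noncomputable def CubeChain.boundary {n : ℕ} (W : CubeChain (n + 1)) : CubeChain n :=
  W.sum fun c m => m • ∑ i : Fin (n + 1), ∑ ε : Fin 2,
    Finsupp.single (c.face i ε) ((-1 : ℤ) ^ ((i : ℕ) + 1 + (ε : ℕ)))

/-- The flux `∫ ⟨Z, ∂₁c × ∂₂c⟩` over `[0,1]²` through a singular 2-cube, that is, the integral over
it of the 2-form that corresponds to `Z`; the triple product is written as a determinant. -/
noncomputable def SmoothCube.flux (c : SmoothCube 2) (Z : Space → Space) : ℝ :=
  ∫ t in Set.Icc (0 : Fin 2 → ℝ) 1,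
    (Matrix.of ![fun k => Z (c.1 t) k, fun k => fderiv ℝ c.1 t (Pi.single 0 1) k,
      fun k => fderiv ℝ c.1 t (Pi.single 1 1) k]).det

/-- The flux through a 2-chain. -/
noncomputable def CubeChain.flux (C : CubeChain 2) (Z : Space → Space) : ℝ :=
  C.sum fun c m => (m : ℝ) * c.flux Z

/-- Two oriented surfaces together bound an oriented 3-chain `W`, namely `∂W = M - M'`. Here `∂W` is
the sum of the faces of `W`, and the two sides are compared in the usual way for 2-chains with
different parametrizations: every smooth 2-form has the same integral over both. -/
def BoundOrientedChain {M M' : Type*}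
    [TopologicalSpace M] [ChartedSpace (EuclideanHalfSpace 2) M] [MeasurableSpace M]
    [TopologicalSpace M'] [ChartedSpace (EuclideanHalfSpace 2) M'] [MeasurableSpace M']
    (x N : M → Space) (y N' : M' → Space) : Prop :=
  ∃ W : CubeChain 3, ∀ Z : Space → Space, ContDiff ℝ ∞ Z →
    W.boundary.flux Z = surfaceFlux x N Z - surfaceFlux y N' Z

end Chains

end RotatingSurface

namespace RotatingSurface

/-! Put `W = √(1 + |∇u|²)` and `ν = ∇u / W`, after extending `u` smoothly from `closure Ω` to the
whole plane. The function `N₃ W` is continuous with square one and `M` is connected, so `N = s (-ν,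
1/W)` with a constant sign `s`; moreover `2H = s div ν`.

Stability. The stationary equation is invariant under vertical translation, so `N₃ = s/W` is a
nowhere vanishing Jacobi function. This suggests writing `f = g / W`. Then `L f = div (A ∇g)` on
`Ω`, where `A = (1 - ν νᵀ) / W` is the positive coefficient matrix of the linearized mean curvature
operator (`divergence_graphFlow`, `IsGraphPart.jacobiOperator_eq`). As `f dM = g dq`, formally `-∫ f
L f dM = ∫ ⟨A ∇g, ∇g⟩ dq ≥ 0` (`graphFlow_nonneg`). To integrate by parts without regularity of
`frontier Ω`, the factor `g` is replaced by `η(g)`, where `η` is nondecreasing and vanishes near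
zero. Since `g` vanishes over `frontier Ω`, this has compact support in `Ω`; dominated convergence
removes the cut-off (`integral_cutoff_mul_divergence_le`).

Minimization. The field `Z = s ((-ν, 1/W) + x₃ div ν · E₃)` has no divergence, so by Stokes it has
zero flux through `∂W` for every 3-chain, and its fluxes through `M` and `M'` agree. Over `closure
Ω` one has `s div ν = a r² + b`, hence `⟨Z, N'⟩ ≤ 1 + (a r² + b) x₃ N'₃` for every unit vector `N'`,
by Cauchy–Schwarz, with equality for the normal of `M`. Integrating, the flux is at most `E(y)` and
equals `E(x)` (`IsOrientedImmersion.flux_calibration_le`, `IsGraphSurface.flux_calibration`). -/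

/-! ### Stokes' theorem for smooth singular cubes -/

/-- The divergence of a vector field on `ℝ³`. -/
noncomputable def divergence (Z : Space → Space) (q : Space) : ℝ :=
  ∑ k : Fin 3, fderiv ℝ Z q (EuclideanSpace.single k 1) k

/-- The triple product of three vectors. -/
noncomputable def tripleProduct (u v w : Space) : ℝ :=
  (Matrix.of ![fun k => u k, fun k => v k, fun k => w k]).det

theorem tripleProduct_eq (u v w : Space) : tripleProduct u v w =
    u 0 * v 1 * w 2 - u 0 * v 2 * w 1 - u 1 * v 0 * w 2 + u 1 * v 2 * w 0 + u 2 * v 0 * w 1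
      - u 2 * v 1 * w 0 := by
  simp [tripleProduct, Matrix.det_fin_three]

theorem hasFDerivAt_tripleProduct {E : Type*} [NormedAddCommGroup E] [NormedSpace ℝ E]
    {u v w : E → Space} {u' v' w' : E →L[ℝ] Space} {t : E}
    (hu : HasFDerivAt u u' t) (hv : HasFDerivAt v v' t) (hw : HasFDerivAt w w' t) :
    ∃ T : E →L[ℝ] ℝ, HasFDerivAt (fun t => tripleProduct (u t) (v t) (w t)) T t ∧
      ∀ e, T e = tripleProduct (u' e) (v t) (w t) + tripleProduct (u t) (v' e) (w t)
        + tripleProduct (u t) (v t) (w' e) := by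
  have co : ∀ {f : E → Space} {f' : E →L[ℝ] Space}, HasFDerivAt f f' t → ∀ k : Fin 3,
      HasFDerivAt (fun t => f t k) ((EuclideanSpace.proj k : Space →L[ℝ] ℝ).comp f') t :=
    fun h k => (EuclideanSpace.proj k : Space →L[ℝ] ℝ).hasFDerivAt.comp t h
  simp only [tripleProduct_eq]
  refine ⟨_, ((((((((co hu 0).mul (co hv 1)).mul (co hw 2)).sub
    (((co hu 0).mul (co hv 2)).mul (co hw 1))).sub
    (((co hu 1).mul (co hv 0)).mul (co hw 2))).add
    (((co hu 1).mul (co hv 2)).mul (co hw 0))).add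
    (((co hu 2).mul (co hv 0)).mul (co hw 1))).sub
    (((co hu 2).mul (co hv 1)).mul (co hw 0))), fun e => ?_⟩
  simp
  ring

theorem clm_apply_eq_sum {n : ℕ} {F : Type*} [NormedAddCommGroup F] [NormedSpace ℝ F]
    (A : EuclideanSpace ℝ (Fin n) →L[ℝ] F) (v : EuclideanSpace ℝ (Fin n)) :
    A v = ∑ k, v k • A (EuclideanSpace.single k 1) := by
  conv_lhs => rw [← (EuclideanSpace.basisFun (Fin n) ℝ).sum_repr v]
  simp

/-- The derivation induced by `A` on the top exterior power is multiplication by its trace. For `A =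
fderiv ℝ Z` this trace is the divergence of `Z`. -/
theorem tripleProduct_trace (A : Space →L[ℝ] Space) (u v w : Space) :
    tripleProduct (A u) v w - tripleProduct (A v) u w + tripleProduct (A w) u v
      = (∑ k : Fin 3, A (EuclideanSpace.single k 1) k) * tripleProduct u v w := by
  rw [clm_apply_eq_sum A u, clm_apply_eq_sum A v, clm_apply_eq_sum A w]
  simp only [tripleProduct_eq, Fin.sum_univ_three, PiLp.add_apply, PiLp.smul_apply, smul_eq_mul]
  ring

theorem tripleProduct_swap (u v w : Space) : tripleProduct u w v = -tripleProduct u v w := by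
  simp only [tripleProduct_eq]; ring

theorem SmoothCube.flux_eq (c : SmoothCube 2) (Z : Space → Space) :
    c.flux Z = ∫ t in Set.Icc (0 : Fin 2 → ℝ) 1,
      tripleProduct (Z (c.1 t)) (fderiv ℝ c.1 t (Pi.single 0 1)) (fderiv ℝ c.1 t (Pi.single 1 1)) :=
  rfl

theorem hasFDerivAt_insertNth {n : ℕ} (i : Fin (n + 1)) (s : ℝ) (t : Fin n → ℝ) :
    ∃ T : (Fin n → ℝ) →L[ℝ] (Fin (n + 1) → ℝ),
      HasFDerivAt (fun t : Fin n → ℝ => (i.insertNth s t : Fin (n + 1) → ℝ)) T t ∧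
      ∀ k, T (Pi.single k 1) = Pi.single (i.succAbove k) 1 := by
  have h := ((contDiff_insertNth i s).differentiable (by simp) t).hasFDerivAt
  refine ⟨_, h, fun k => ?_⟩
  have hc := hasFDerivAt_pi'.1 h
  ext j
  refine Fin.succAboveCases i ?_ (fun l => ?_) j
  · have h1 := hc i
    simp only [Fin.insertNth_apply_same] at h1
    have := congrArg (fun A => A (Pi.single k 1)) (h1.unique (hasFDerivAt_const s t))
    simpa using this
  · have h1 := hc (i.succAbove l)
    simp only [Fin.insertNth_apply_succAbove] at h1
    have := congrArg (fun A => A (Pi.single k 1)) (h1.unique (hasFDerivAt_apply l t))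
    simp at this
    rw [this]
    by_cases hlk : l = k
    · subst hlk; simp
    · rw [Pi.single_eq_of_ne hlk, Pi.single_eq_of_ne]
      exact fun h => hlk (Fin.succAbove_right_injective h)

theorem SmoothCube.fderiv_face {n : ℕ} (c : SmoothCube (n + 1)) (i : Fin (n + 1)) (ε : Fin 2)
    (t : Fin n → ℝ) (k : Fin n) :
    fderiv ℝ (c.face i ε).1 t (Pi.single k 1)
      = fderiv ℝ c.1 (i.insertNth ((ε : ℕ) : ℝ) t) (Pi.single (i.succAbove k) 1) := by
  obtain ⟨T, hT, h⟩ := hasFDerivAt_insertNth i ((ε : ℕ) : ℝ) t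
  have hc := (c.2.differentiable (by simp) (i.insertNth ((ε : ℕ) : ℝ) t)).hasFDerivAt
  have : HasFDerivAt (c.face i ε).1 _ t := hc.comp t hT
  rw [this.fderiv, ContinuousLinearMap.comp_apply, h]

/-- The component of the pulled back 2-form that belongs to the `i`-th pair of opposite faces. -/
noncomputable def SmoothCube.pullback (c : SmoothCube 3) (Z : Space → Space) (i : Fin 3)
    (t : Fin 3 → ℝ) : ℝ :=
  (-1) ^ (i : ℕ) * tripleProduct (Z (c.1 t)) (fderiv ℝ c.1 t (Pi.single (i.succAbove 0) 1))
    (fderiv ℝ c.1 t (Pi.single (i.succAbove 1) 1))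

theorem SmoothCube.flux_face (c : SmoothCube 3) (Z : Space → Space) (i : Fin 3) (ε : Fin 2) :
    (-1) ^ (i : ℕ) * (c.face i ε).flux Z
      = ∫ t in Set.Icc (0 : Fin 2 → ℝ) 1, c.pullback Z i (i.insertNth ((ε : ℕ) : ℝ) t) := by
  rw [SmoothCube.flux_eq, ← integral_const_mul]
  simp only [SmoothCube.fderiv_face]
  rfl

/-- This is `d(c*ω) = c*(dω)`: the derivatives of `Z` combine by `tripleProduct_trace`, and the
second derivatives of `c` cancel in pairs, being symmetric inside an alternating product. -/
theorem SmoothCube.divergence_pullback (c : SmoothCube 3) {Z : Space → Space}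
    (hZ : ContDiff ℝ ∞ Z) (t : Fin 3 → ℝ) :
    ∃ T : Fin 3 → ((Fin 3 → ℝ) →L[ℝ] ℝ), (∀ i, HasFDerivAt (c.pullback Z i) (T i) t) ∧
      ∑ i, T i (Pi.single i 1) = divergence Z (c.1 t) *
        tripleProduct (fderiv ℝ c.1 t (Pi.single 0 1)) (fderiv ℝ c.1 t (Pi.single 1 1))
          (fderiv ℝ c.1 t (Pi.single 2 1)) := by
  have hc : HasFDerivAt c.1 (fderiv ℝ c.1 t) t := (c.2.differentiable (by simp) t).hasFDerivAt
  have hZc : HasFDerivAt (fun t => Z (c.1 t)) ((fderiv ℝ Z (c.1 t)).comp (fderiv ℝ c.1 t)) t :=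
    ((hZ.differentiable (by simp) (c.1 t)).hasFDerivAt).comp t hc
  have hd : ContDiff ℝ ∞ (fderiv ℝ c.1) := c.2.fderiv_right (by simp)
  have hc2 : HasFDerivAt (fderiv ℝ c.1) (fderiv ℝ (fderiv ℝ c.1) t) t :=
    (hd.differentiable (by simp) t).hasFDerivAt
  have hp : ∀ e, HasFDerivAt (fun t => fderiv ℝ c.1 t e)
      ((ContinuousLinearMap.apply ℝ Space e).comp (fderiv ℝ (fderiv ℝ c.1) t)) t :=
    fun e => (ContinuousLinearMap.apply ℝ Space e).hasFDerivAt.comp t hc2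
  have hs : ∀ e e', fderiv ℝ (fderiv ℝ c.1) t e e' = fderiv ℝ (fderiv ℝ c.1) t e' e := by
    have := (c.2.contDiffAt (x := t)).isSymmSndFDerivAt
      (by simp; exact WithTop.coe_le_coe.2 le_top)
    exact fun e e' => this e e'
  choose T hT hTe using fun i : Fin 3 => hasFDerivAt_tripleProduct hZc
    (hp (Pi.single (i.succAbove 0) 1)) (hp (Pi.single (i.succAbove 1) 1))
  refine ⟨fun i => ((-1 : ℝ) ^ (i : ℕ)) • T i, fun i => (hT i).const_mul _, ?_⟩
  simp only [Fin.sum_univ_three, smul_apply, hTe, smul_eq_mul,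
    ContinuousLinearMap.comp_apply, ContinuousLinearMap.apply_apply]
  have s00 : (0 : Fin 3).succAbove 0 = 1 := rfl
  have s01 : (0 : Fin 3).succAbove 1 = 2 := rfl
  have s10 : (1 : Fin 3).succAbove 0 = 0 := rfl
  have s11 : (1 : Fin 3).succAbove 1 = 2 := rfl
  have s20 : (2 : Fin 3).succAbove 0 = 0 := rfl
  have s21 : (2 : Fin 3).succAbove 1 = 1 := rfl
  rw [s00, s01, s10, s11, s20, s21, divergence, ← tripleProduct_trace]
  rw [hs (Pi.single 1 1) (Pi.single 0 1), hs (Pi.single 2 1) (Pi.single 0 1),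
    hs (Pi.single 2 1) (Pi.single 1 1)]
  simp only [Fin.val_zero, Fin.val_one, Fin.val_two, pow_zero, pow_one, one_mul]
  rw [tripleProduct_swap _ (fderiv ℝ c.1 t (Pi.single 2 1))
      ((fderiv ℝ (fderiv ℝ c.1) t (Pi.single 0 1)) (Pi.single 1 1)),
    tripleProduct_swap _ (fderiv ℝ c.1 t (Pi.single 1 1))
      ((fderiv ℝ (fderiv ℝ c.1) t (Pi.single 0 1)) (Pi.single 2 1))]
  rw [tripleProduct_swap _ ((fderiv ℝ (fderiv ℝ c.1) t (Pi.single 1 1)) (Pi.single 2 1))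
      (fderiv ℝ c.1 t (Pi.single 0 1))]
  ring

/-- The flux of a divergence-free field through the boundary of a cube vanishes. -/
theorem SmoothCube.sum_flux_face_eq_zero (c : SmoothCube 3) {Z : Space → Space}
    (hZ : ContDiff ℝ ∞ Z) (hdiv : ∀ q, divergence Z q = 0) :
    ∑ i : Fin 3, ∑ ε : Fin 2, (-1 : ℝ) ^ ((i : ℕ) + 1 + (ε : ℕ)) * (c.face i ε).flux Z = 0 := by
  choose T hT hsum using fun t => c.divergence_pullback hZ t
  simp only [hdiv, zero_mul] at hsum
  have key := integral_divergence_of_hasFDerivAt_off_countable' (0 : Fin 3 → ℝ) 1 zero_le_one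
    (fun i => c.pullback Z i) (fun i t => T t i) ∅ Set.countable_empty
    (fun i t _ => (hT t i).continuousAt.continuousWithinAt) (fun t _ i => hT t i)
    (by simp [hsum])
  simp only [hsum, integral_zero, Pi.zero_apply, Pi.one_apply] at key
  rw [key]
  refine Finset.sum_congr rfl fun i _ => ?_
  -- With `i` counted from `0`, the sign of the chain boundary is `(-1)^i` on the face `ε = 1` and
  -- its negative on the face `ε = 0`, as in the divergence theorem on a box.
  have h0 := c.flux_face Z i 0
  have h1 := c.flux_face Z i 1
  simp only [Fin.val_zero, Fin.val_one, Nat.cast_zero, Nat.cast_one] at h0 h1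
  rw [Fin.sum_univ_two]
  change _ = (∫ t in Set.Icc (0 : Fin 2 → ℝ) 1, c.pullback Z i (i.insertNth 1 t))
    - ∫ t in Set.Icc (0 : Fin 2 → ℝ) 1, c.pullback Z i (i.insertNth 0 t)
  rw [← h0, ← h1]
  simp only [pow_add, Fin.val_zero, Fin.val_one, pow_zero, pow_one]
  ring

theorem CubeChain.flux_add (C D : CubeChain 2) (Z : Space → Space) :
    (C + D).flux Z = C.flux Z + D.flux Z := by
  classical
  exact Finsupp.sum_add_index' (by simp) (by intros; push_cast; ring)

theorem CubeChain.flux_single (c : SmoothCube 2) (m : ℤ) (Z : Space → Space) :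
    CubeChain.flux (Finsupp.single c m) Z = m * c.flux Z :=
  Finsupp.sum_single_index (by simp)

/-- The flux as a homomorphism on chains. -/
noncomputable def CubeChain.fluxHom (Z : Space → Space) : CubeChain 2 →+ ℝ where
  toFun C := C.flux Z
  map_zero' := Finsupp.sum_zero_index
  map_add' C D := C.flux_add D Z

theorem CubeChain.flux_boundary_eq_zero (C : CubeChain 3) {Z : Space → Space}
    (hZ : ContDiff ℝ ∞ Z) (hdiv : ∀ q, divergence Z q = 0) : C.boundary.flux Z = 0 := by
  change CubeChain.fluxHom Z C.boundary = 0
  rw [CubeChain.boundary, Finsupp.sum, map_sum]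
  refine Finset.sum_eq_zero fun c _ => ?_
  rw [map_zsmul, map_sum]
  simp only [map_sum]
  have : ∀ (i : Fin 3) (ε : Fin 2), CubeChain.fluxHom Z
      (Finsupp.single (c.face i ε) ((-1 : ℤ) ^ ((i : ℕ) + 1 + (ε : ℕ))))
      = (-1 : ℝ) ^ ((i : ℕ) + 1 + (ε : ℕ)) * (c.face i ε).flux Z := fun i ε => by
    change CubeChain.flux _ Z = _
    rw [CubeChain.flux_single]; push_cast; rfl
  simp only [this, c.sum_flux_face_eq_zero hZ hdiv, smul_zero]

/-! ### The area measure of an immersed surface -/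

section Gram

/-- The Gram matrix of a linear map from the plane to space. -/
noncomputable def gramMatrix (A : Plane →L[ℝ] Space) : Matrix (Fin 2) (Fin 2) ℝ :=
  Matrix.of fun i j => inner ℝ (A (EuclideanSpace.single i 1)) (A (EuclideanSpace.single j 1))

/-- The matrix whose `i`-th column is the image of the `i`-th coordinate vector. -/
noncomputable def planeMatrix (T : Plane →L[ℝ] Plane) : Matrix (Fin 2) (Fin 2) ℝ :=
  Matrix.of fun k i => T (EuclideanSpace.single i 1) k

theorem det_planeMatrix (T : Plane →L[ℝ] Plane) : (planeMatrix T).det = T.det := by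
  rw [ContinuousLinearMap.det,
    ← LinearMap.det_toMatrix (EuclideanSpace.basisFun (Fin 2) ℝ).toBasis]
  congr 1

/-- Two different maps are allowed so that one formula serves the first form, the second form and
the divergence. -/
theorem pairing_comp (A B : Plane →L[ℝ] Space) (T : Plane →L[ℝ] Plane) :
    (Matrix.of fun i j => inner ℝ (A (T (EuclideanSpace.single i 1)))
      (B (T (EuclideanSpace.single j 1))) : Matrix (Fin 2) (Fin 2) ℝ)
    = (planeMatrix T).transpose * (Matrix.of fun i j => inner ℝ (A (EuclideanSpace.single i 1))
      (B (EuclideanSpace.single j 1))) * planeMatrix T := by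
  ext i j
  rw [Matrix.of_apply, clm_apply_eq_sum A, clm_apply_eq_sum B]
  simp only [Matrix.mul_apply, Fin.sum_univ_two, inner_add_left, inner_add_right,
    inner_smul_left, inner_smul_right, planeMatrix, Matrix.transpose_apply, Matrix.of_apply,
    conj_trivial]
  ring

theorem transpose_gramMatrix (A : Plane →L[ℝ] Space) : (gramMatrix A).transpose = gramMatrix A := by
  ext i j
  simp [gramMatrix, real_inner_comm]

theorem sqrt_det_gramMatrix_comp (A : Plane →L[ℝ] Space) (T : Plane →L[ℝ] Plane) :
    √(gramMatrix (A.comp T)).det = |T.det| * √(gramMatrix A).det := by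
  have : gramMatrix (A.comp T) = (planeMatrix T).transpose * gramMatrix A * planeMatrix T :=
    pairing_comp A A T
  rw [this, Matrix.det_mul, Matrix.det_mul, Matrix.det_transpose, det_planeMatrix,
    mul_right_comm, ← sq, Real.sqrt_mul (sq_nonneg _), Real.sqrt_sq_eq_abs]

end Gram

variable {M : Type*} [TopologicalSpace M] [ChartedSpace (EuclideanHalfSpace 2) M]

theorem chartGram_eq (x : M → Space) (p : M) (z : Plane) : chartGram x p z =
    gramMatrix (fderivWithin ℝ (x ∘ (extChartAt (𝓡∂ 2) p).symm) (Set.range (𝓡∂ 2)) z) := rfl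

theorem measurableSet_extChartAt_target (p : M) :
    MeasurableSet (extChartAt (𝓡∂ 2) p).target := by
  rw [extChartAt_target]
  exact (((chartAt (EuclideanHalfSpace 2) p).open_target.preimage
    (𝓡∂ 2).continuous_symm).measurableSet).inter (𝓡∂ 2).isClosed_range.measurableSet

theorem extChartAt_target_subset_modelRange (p : M) :
    (extChartAt (𝓡∂ 2) p).target ⊆ Set.range (𝓡∂ 2) := extChartAt_target_subset_range p

section Measurable

variable [MeasurableSpace M] [BorelSpace M]

theorem measurableSet_symm_preimage (p : M) {A : Set M} (hA : MeasurableSet A) :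
    MeasurableSet ((extChartAt (𝓡∂ 2) p).symm ⁻¹' A ∩ (extChartAt (𝓡∂ 2) p).target) := by
  have h : Measurable ((extChartAt (𝓡∂ 2) p).target.domRestrict (extChartAt (𝓡∂ 2) p).symm) :=
    (continuousOn_extChartAt_symm p).domRestrict.measurable
  have := (MeasurableEmbedding.subtype_coe
    (measurableSet_extChartAt_target p)).measurableSet_image' (h hA)
  rw [Set.inter_comm, ← Subtype.image_preimage_coe]
  exact this

theorem aemeasurable_extChartAt_symm (x : M → Space) (p : M) :
    AEMeasurable (extChartAt (𝓡∂ 2) p).symm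
      ((volume.restrict (extChartAt (𝓡∂ 2) p).target).withDensity
        fun z => ENNReal.ofReal (Real.sqrt (chartGram x p z).det)) :=
  ((continuousOn_extChartAt_symm p).aemeasurable (measurableSet_extChartAt_target p)).mono_ac
    (withDensity_absolutelyContinuous _ _)

theorem chartArea_apply (x : M → Space) (p : M) {A : Set M} (hA : MeasurableSet A) :
    chartArea x p A = ∫⁻ z in (extChartAt (𝓡∂ 2) p).symm ⁻¹' A ∩ (extChartAt (𝓡∂ 2) p).target,
      ENNReal.ofReal (Real.sqrt (chartGram x p z).det) := by
  rw [chartArea, Measure.map_apply_of_aemeasurable (aemeasurable_extChartAt_symm x p) hA,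
    withDensity_apply', Measure.restrict_restrict' (measurableSet_extChartAt_target p)]

theorem chartArea_compl_source (x : M → Space) (p : M) :
    chartArea x p (extChartAt (𝓡∂ 2) p).sourceᶜ = 0 := by
  rw [chartArea_apply x p (isOpen_extChartAt_source p).measurableSet.compl]
  have : (extChartAt (𝓡∂ 2) p).symm ⁻¹' (extChartAt (𝓡∂ 2) p).sourceᶜ
      ∩ (extChartAt (𝓡∂ 2) p).target = ∅ := by
    ext z
    simp only [Set.mem_inter_iff, Set.mem_preimage, Set.mem_compl_iff, Set.mem_empty_iff_false,
      iff_false, not_and]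
    exact fun h hz => h ((extChartAt (𝓡∂ 2) p).map_target hz)
  rw [this]; simp

/-- Change of variables for the area of a part of a chart. -/
theorem chartArea_eq_lintegral_image (x : M → Space) (p : M) {A : Set M} (hA : MeasurableSet A)
    {T : Plane → Plane} {T' : Plane → Plane →L[ℝ] Plane} {ρ : Plane → ℝ}
    (hT : ∀ z ∈ (extChartAt (𝓡∂ 2) p).symm ⁻¹' A ∩ (extChartAt (𝓡∂ 2) p).target,
      HasFDerivWithinAt T (T' z) (Set.range (𝓡∂ 2)) z)
    (hinj : Set.InjOn T ((extChartAt (𝓡∂ 2) p).symm ⁻¹' A ∩ (extChartAt (𝓡∂ 2) p).target))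
    (hρ : ∀ z ∈ (extChartAt (𝓡∂ 2) p).symm ⁻¹' A ∩ (extChartAt (𝓡∂ 2) p).target,
      √(chartGram x p z).det = |(T' z).det| * ρ (T z)) :
    chartArea x p A =
      ∫⁻ w in T '' ((extChartAt (𝓡∂ 2) p).symm ⁻¹' A ∩ (extChartAt (𝓡∂ 2) p).target),
        ENNReal.ofReal (ρ w) := by
  rw [chartArea_apply x p hA, lintegral_image_eq_lintegral_abs_det_fderiv_mul volume
    (measurableSet_symm_preimage p hA) (fun z hz => (hT z hz).mono
      (Set.inter_subset_right.trans (extChartAt_target_subset_modelRange p))) hinj]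
  refine setLIntegral_congr_fun (measurableSet_symm_preimage p hA) fun z hz => ?_
  simp only [hρ z hz]
  rw [ENNReal.ofReal_mul (abs_nonneg _)]

end Measurable

section Smooth

variable {E : Type*} [NormedAddCommGroup E] [NormedSpace ℝ E]

theorem contDiffWithinAt_comp_extChartAt_symm [IsManifold (𝓡∂ 2) ∞ M] {V : M → E}
    (hV : ContMDiff (𝓡∂ 2) 𝓘(ℝ, E) ∞ V) (p : M) {z : Plane}
    (hz : z ∈ (extChartAt (𝓡∂ 2) p).target) :
    ContDiffWithinAt ℝ ∞ (V ∘ (extChartAt (𝓡∂ 2) p).symm) (Set.range (𝓡∂ 2)) z := by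
  have h := (hV.comp_contMDiffOn (contMDiffOn_extChartAt_symm (n := ∞) p)).contDiffOn z hz
  exact h.mono_of_mem_nhdsWithin (extChartAt_target_mem_nhdsWithin_of_mem hz)

variable [IsManifold (𝓡∂ 2) ∞ M] [MeasurableSpace M] [BorelSpace M]

/-- The area measures of two charts agree on the overlap. -/
theorem chartArea_eq_chartArea {x : M → Space} (hx : ContMDiff (𝓡∂ 2) 𝓘(ℝ, Space) ∞ x) (p q : M)
    {A : Set M} (hA : MeasurableSet A) (hp : A ⊆ (extChartAt (𝓡∂ 2) p).source)
    (hq : A ⊆ (extChartAt (𝓡∂ 2) q).source) : chartArea x q A = chartArea x p A := by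
  set φ := extChartAt (𝓡∂ 2) p
  set ψ := extChartAt (𝓡∂ 2) q
  have hmem : ∀ z ∈ ψ.symm ⁻¹' A ∩ ψ.target, z ∈ (ψ.symm ≫ φ).source := fun z hz => by
    rw [PartialEquiv.trans_source]
    exact ⟨hz.2, hp hz.1⟩
  have hT : ∀ z ∈ ψ.symm ⁻¹' A ∩ ψ.target, HasFDerivWithinAt (φ ∘ ψ.symm)
      (fderivWithin ℝ (φ ∘ ψ.symm) (Set.range (𝓡∂ 2)) z) (Set.range (𝓡∂ 2)) z := fun z hz =>
    ((contDiffWithinAt_ext_coord_change (n := ∞) p q (hmem z hz)).differentiableWithinAt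
      (by simp)).hasFDerivWithinAt
  have himage : (φ ∘ ψ.symm) '' (ψ.symm ⁻¹' A ∩ ψ.target) = φ.symm ⁻¹' A ∩ φ.target := by
    ext w
    constructor
    · rintro ⟨z, hz, rfl⟩
      exact ⟨by simpa [φ.left_inv (hp hz.1)] using hz.1, φ.map_source (hp hz.1)⟩
    · rintro ⟨hw, hw'⟩
      refine ⟨ψ (φ.symm w), ⟨?_, ψ.map_source (hq hw)⟩, ?_⟩
      · rw [Set.mem_preimage, ψ.left_inv (hq hw)]; exact hw
      · rw [Function.comp_apply, ψ.left_inv (hq hw), φ.right_inv hw']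
  rw [chartArea_eq_lintegral_image x q hA hT (ρ := fun w => √(chartGram x p w).det), himage,
    chartArea_apply x p hA]
  · intro z hz z' hz' h
    have := φ.injOn (hp hz.1) (hp hz'.1) h
    exact ψ.symm.injOn hz.2 hz'.2 this
  · intro z hz
    have hw : φ (ψ.symm z) ∈ φ.target := φ.map_source (hp hz.1)
    have hg := ((contDiffWithinAt_comp_extChartAt_symm hx p hw).differentiableWithinAt
      (by simp)).hasFDerivWithinAt
    -- The overlap is a neighbourhood of `z` relative to the half-plane, so derivatives within the
    -- two sets coincide, also at boundary points.
    have hs : (ψ.symm ≫ φ).source ∈ nhdsWithin z (Set.range (𝓡∂ 2)) :=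
      by
      rw [PartialEquiv.trans_source, Set.inter_comm]
      exact Filter.inter_mem (((continuousOn_extChartAt_symm q z hz.2).mono_of_mem_nhdsWithin
        (extChartAt_target_mem_nhdsWithin_of_mem hz.2)).preimage_mem_nhdsWithin
        ((isOpen_extChartAt_source p).mem_nhds (hp hz.1)))
        (extChartAt_target_mem_nhdsWithin_of_mem hz.2)
    have hsub : (ψ.symm ≫ φ).source ⊆ Set.range (𝓡∂ 2) := fun w hw =>
      extChartAt_target_subset_modelRange q (by rw [PartialEquiv.trans_source] at hw; exact hw.1)
    have hc : HasFDerivWithinAt (x ∘ ψ.symm) _ (ψ.symm ≫ φ).source z :=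
      (HasFDerivWithinAt.comp z hg ((hT z hz).mono hsub) (fun w hw => by
        rw [PartialEquiv.trans_source] at hw
        exact extChartAt_target_subset_modelRange p (φ.map_source hw.2))).congr'
        (fun w hw => by
          rw [PartialEquiv.trans_source] at hw
          simp only [Function.comp_apply]
          rw [φ.left_inv hw.2]) (hmem z hz)
    have hc' := (hc.mono_of_mem_nhdsWithin hs).fderivWithin
      ((𝓡∂ 2).uniqueDiffOn z (extChartAt_target_subset_modelRange q hz.2))
    rw [chartGram_eq, hc', sqrt_det_gramMatrix_comp]
    rfl

theorem areaMeasure_apply {x : M → Space} (hx : ContMDiff (𝓡∂ 2) 𝓘(ℝ, Space) ∞ x) (p : M)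
    {A : Set M} (hA : MeasurableSet A) (hp : A ⊆ (extChartAt (𝓡∂ 2) p).source) :
    areaMeasure x A = chartArea x p A := by
  have hs : ∀ q : M, MeasurableSet (extChartAt (𝓡∂ 2) q).source := fun q =>
    (isOpen_extChartAt_source q).measurableSet
  refine le_antisymm ?_ (Measure.le_iff.1 (le_iSup (fun p => chartArea x p) p) A hA)
  -- The right side dominates every chart measure: on the source of the chart at `p` all charts
  -- agree with this one, and off it the supremum is itself a bound.
  have h : areaMeasure x ≤ chartArea x p
      + (areaMeasure x).restrict (extChartAt (𝓡∂ 2) p).sourceᶜ := by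
    refine iSup_le fun q => Measure.le_iff.2 fun B hB => ?_
    rw [← measure_inter_add_sdiff B (hs p), Measure.add_apply, Measure.restrict_apply hB]
    refine add_le_add ?_ (Measure.le_iff.1 (le_iSup (fun p => chartArea x p) q) _
      (hB.diff (hs p)))
    rw [← measure_inter_add_sdiff (B ∩ (extChartAt (𝓡∂ 2) p).source) (hs q)]
    have h0 : chartArea x q ((B ∩ (extChartAt (𝓡∂ 2) p).source) \ (extChartAt (𝓡∂ 2) q).source)
        = 0 := measure_mono_null (fun w hw => hw.2) (chartArea_compl_source x q)
    rw [h0, add_zero, chartArea_eq_chartArea hx p q ((hB.inter (hs p)).inter (hs q))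
      (fun w hw => hw.1.2) fun w hw => hw.2]
    exact measure_mono fun w hw => hw.1.1
  refine (Measure.le_iff.1 h A hA).trans ?_
  rw [Measure.add_apply, Measure.restrict_apply hA]
  have : A ∩ (extChartAt (𝓡∂ 2) p).sourceᶜ = ∅ := by
    ext w; simpa using fun hw => hp hw
  rw [this, measure_empty, add_zero]

/-- The density is continuous at `p`, hence bounded on a small ball. Local finiteness and
compactness then make the total area finite, so that continuous functions are integrable. -/
theorem exists_chartArea_lt_top {x : M → Space} (hx : ContMDiff (𝓡∂ 2) 𝓘(ℝ, Space) ∞ x) (p : M) :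
    ∃ V : Set M, IsOpen V ∧ p ∈ V ∧ V ⊆ (extChartAt (𝓡∂ 2) p).source ∧ chartArea x p V < ⊤ := by
  set φ := extChartAt (𝓡∂ 2) p
  have hz : φ p ∈ φ.target := mem_extChartAt_target p
  have hc : ContinuousWithinAt (fun z => √(chartGram x p z).det) (Set.range (𝓡∂ 2)) (φ p) := by
    have hd := ((contDiffWithinAt_comp_extChartAt_symm hx p hz).fderivWithin_right (m := 0)
      (𝓡∂ 2).uniqueDiffOn (by simp) (extChartAt_target_subset_modelRange p hz)).continuousWithinAt
    refine Real.continuous_sqrt.continuousAt.comp_continuousWithinAt ?_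
    simp only [chartGram, Matrix.det_fin_two, Matrix.of_apply]
    have hi : ∀ e, ContinuousWithinAt (fun z => fderivWithin ℝ (x ∘ φ.symm) (Set.range (𝓡∂ 2)) z e)
        (Set.range (𝓡∂ 2)) (φ p) := fun e => hd.clm_apply continuousWithinAt_const
    exact (((hi _).inner (hi _)).mul ((hi _).inner (hi _))).sub
      (((hi _).inner (hi _)).mul ((hi _).inner (hi _)))
  set C := √(chartGram x p (φ p)).det + 1
  have hlt : ∀ᶠ z in nhdsWithin (φ p) (Set.range (𝓡∂ 2)), √(chartGram x p z).det < C :=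
    hc.eventually_lt continuousWithinAt_const (lt_add_one _)
  obtain ⟨r, hr, hsub⟩ := Metric.mem_nhdsWithin_iff.1 hlt
  have hV : IsOpen (φ.source ∩ φ ⁻¹' Metric.ball (φ p) r) := by
    rw [extChartAt_source]
    exact isOpen_extChartAt_preimage p Metric.isOpen_ball
  refine ⟨_, hV, ⟨mem_extChartAt_source p, Metric.mem_ball_self hr⟩, Set.inter_subset_left, ?_⟩
  rw [chartArea_apply x p hV.measurableSet]
  have hS : φ.symm ⁻¹' (φ.source ∩ φ ⁻¹' Metric.ball (φ p) r) ∩ φ.target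
      ⊆ Metric.ball (φ p) r ∩ Set.range (𝓡∂ 2) := fun z hz' => by
    refine ⟨?_, extChartAt_target_subset_modelRange p hz'.2⟩
    have := hz'.1.2
    rwa [Set.mem_preimage, φ.right_inv hz'.2] at this
  calc _ ≤ ∫⁻ _z in φ.symm ⁻¹' (φ.source ∩ φ ⁻¹' Metric.ball (φ p) r) ∩ φ.target,
        ENNReal.ofReal C := setLIntegral_mono' (measurableSet_symm_preimage p hV.measurableSet)
          fun z hz' => ENNReal.ofReal_le_ofReal (hsub (hS hz')).le
    _ = ENNReal.ofReal C * volume (φ.symm ⁻¹' (φ.source ∩ φ ⁻¹' Metric.ball (φ p) r)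
        ∩ φ.target) := setLIntegral_const _ _
    _ < ⊤ := ENNReal.mul_lt_top ENNReal.ofReal_lt_top
        ((measure_mono (hS.trans Set.inter_subset_left)).trans_lt measure_ball_lt_top)

theorem isFiniteMeasure_areaMeasure [CompactSpace M] {x : M → Space}
    (hx : ContMDiff (𝓡∂ 2) 𝓘(ℝ, Space) ∞ x) : IsFiniteMeasure (areaMeasure x) := by
  have : IsLocallyFiniteMeasure (areaMeasure x) := ⟨fun p => by
    obtain ⟨V, hV, hpV, hs, hlt⟩ := exists_chartArea_lt_top hx p
    exact ⟨V, hV.mem_nhds hpV, by rwa [areaMeasure_apply hx p hV.measurableSet hs]⟩⟩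
  exact ⟨isCompact_univ.measure_lt_top⟩

end Smooth

/-! ### Calculus on the plane for the graph of a function -/

/-- The partial derivative of a real function on the plane. -/
noncomputable def pderiv (i : Fin 2) (F : Plane → ℝ) (q : Plane) : ℝ :=
  fderiv ℝ F q (EuclideanSpace.single i 1)

section Pderiv

variable {F G : Plane → ℝ} {q : Plane} (i j : Fin 2)

theorem pderiv_add (hF : DifferentiableAt ℝ F q) (hG : DifferentiableAt ℝ G q) :
    pderiv i (fun q => F q + G q) q = pderiv i F q + pderiv i G q := by
  simp [pderiv, fderiv_fun_add hF hG]

theorem pderiv_mul (hF : DifferentiableAt ℝ F q) (hG : DifferentiableAt ℝ G q) :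
    pderiv i (fun q => F q * G q) q = pderiv i F q * G q + F q * pderiv i G q := by
  simp [pderiv, fderiv_fun_mul hF hG]; ring

theorem pderiv_congr (h : F =ᶠ[nhds q] G) : pderiv i F q = pderiv i G q := by
  rw [pderiv, pderiv, h.fderiv_eq]

theorem pderiv_coord : pderiv i (fun q => q j) q = if i = j then 1 else 0 := by
  have : HasFDerivAt (fun q : Plane => q j) (EuclideanSpace.proj j : Plane →L[ℝ] ℝ) q :=
    (EuclideanSpace.proj j : Plane →L[ℝ] ℝ).hasFDerivAt
  rw [pderiv, this.fderiv]
  simp [eq_comm]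

theorem fderiv_apply_eq_pderiv (v : Plane) : fderiv ℝ F q v = ∑ k, v k * pderiv k F q := by
  rw [clm_apply_eq_sum]; rfl

theorem contDiffAt_pderiv (hF : ContDiffAt ℝ ∞ F q) : ContDiffAt ℝ ∞ (pderiv i F) q :=
  (hF.fderiv_right (by simp)).clm_apply contDiffAt_const

theorem contDiff_pderiv (hF : ContDiff ℝ ∞ F) : ContDiff ℝ ∞ (pderiv i F) :=
  (hF.fderiv_right (by simp)).clm_apply contDiff_const

theorem pderiv_comm (hF : ContDiffAt ℝ ∞ F q) :
    pderiv i (pderiv j F) q = pderiv j (pderiv i F) q := by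
  have hd : DifferentiableAt ℝ (fderiv ℝ F) q :=
    (hF.fderiv_right (m := ∞) (by simp)).differentiableAt (by simp)
  have hp : ∀ e, fderiv ℝ (fun q => fderiv ℝ F q e) q
      = (ContinuousLinearMap.apply ℝ ℝ e).comp (fderiv ℝ (fderiv ℝ F) q) :=
    fun e => ((ContinuousLinearMap.apply ℝ ℝ e).hasFDerivAt.comp q hd.hasFDerivAt).fderiv
  have hs := hF.isSymmSndFDerivAt (by simp; exact WithTop.coe_le_coe.2 le_top)
  change fderiv ℝ (fun q => fderiv ℝ F q _) q _ = fderiv ℝ (fun q => fderiv ℝ F q _) q _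
  rw [hp, hp]
  exact hs _ _

end Pderiv

/-- The area density `√(1 + |∇u|²)` of the graph of `u`. -/
noncomputable def graphDensity (u : Plane → ℝ) (q : Plane) : ℝ :=
  √(1 + pderiv 0 u q ^ 2 + pderiv 1 u q ^ 2)

/-- The components of `∇u / √(1 + |∇u|²)`. -/
noncomputable def graphSlope (u : Plane → ℝ) (i : Fin 2) (q : Plane) : ℝ :=
  pderiv i u q / graphDensity u q

/-- The parametrization of the graph of `u` by the plane. -/
noncomputable def graphMap (u : Plane → ℝ) (q : Plane) : Space := !₂[q 0, q 1, u q]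

/-- The upward unit normal of the graph of `u`. -/
noncomputable def graphNormal (u : Plane → ℝ) (q : Plane) : Space :=
  !₂[-graphSlope u 0 q, -graphSlope u 1 q, 1 / graphDensity u q]

/-- The divergence of `∇u / √(1 + |∇u|²)`, which is twice the mean curvature of the graph. -/
noncomputable def graphCurvature (u : Plane → ℝ) (q : Plane) : ℝ :=
  ∑ j, pderiv j (graphSlope u j) q

/-- The components of the gradient of `f` in the metric of the graph of `u`. -/
noncomputable def graphGradient (u f : Plane → ℝ) (k : Fin 2) (q : Plane) : ℝ :=
  pderiv k f q - graphSlope u k q * ∑ l, graphSlope u l q * pderiv l f q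

/-- The field whose divergence is the linearization at `u` of the mean curvature operator. -/
noncomputable def graphFlow (u g : Plane → ℝ) (k : Fin 2) (q : Plane) : ℝ :=
  graphGradient u g k q / graphDensity u q

/-- The derivative of `∇u / √(1 + |∇u|²)` along itself. -/
noncomputable def graphAccel (u : Plane → ℝ) (k : Fin 2) (q : Plane) : ℝ :=
  ∑ i, graphSlope u i q * pderiv i (graphSlope u k) q

section Graph

variable {u f : Plane → ℝ} {q : Plane}

theorem graphDensity_pos (u : Plane → ℝ) (q : Plane) : 0 < graphDensity u q :=
  Real.sqrt_pos.2 (by positivity)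

theorem graphDensity_sq (u : Plane → ℝ) (q : Plane) :
    graphDensity u q ^ 2 = 1 + pderiv 0 u q ^ 2 + pderiv 1 u q ^ 2 :=
  Real.sq_sqrt (by positivity)

theorem graphSlope_mul (u : Plane → ℝ) (i : Fin 2) (q : Plane) :
    graphSlope u i q * graphDensity u q = pderiv i u q :=
  div_mul_cancel₀ _ (graphDensity_pos u q).ne'

theorem graphSlope_sq (u : Plane → ℝ) (q : Plane) :
    graphSlope u 0 q ^ 2 + graphSlope u 1 q ^ 2 + (1 / graphDensity u q) ^ 2 = 1 := by
  have h := graphDensity_sq u q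
  have h0 := (graphDensity_pos u q).ne'
  simp only [graphSlope]
  field_simp
  linarith

theorem norm_graphNormal (u : Plane → ℝ) (q : Plane) : ‖graphNormal u q‖ = 1 := by
  have := graphSlope_sq u q
  rw [EuclideanSpace.norm_eq, Fin.sum_univ_three]
  simp [graphNormal] at *
  linarith

theorem contDiff_graphDensity (hu : ContDiff ℝ ∞ u) : ContDiff ℝ ∞ (graphDensity u) :=
  ContDiff.sqrt ((contDiff_const.add ((contDiff_pderiv 0 hu).pow 2)).add
    ((contDiff_pderiv 1 hu).pow 2)) fun q => by positivity

theorem contDiff_graphSlope (hu : ContDiff ℝ ∞ u) (i : Fin 2) : ContDiff ℝ ∞ (graphSlope u i) :=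
  (contDiff_pderiv i hu).div (contDiff_graphDensity hu) fun q => (graphDensity_pos u q).ne'

theorem contDiff_inv_graphDensity (hu : ContDiff ℝ ∞ u) :
    ContDiff ℝ ∞ fun q => 1 / graphDensity u q :=
  contDiff_const.div (contDiff_graphDensity hu) fun q => (graphDensity_pos u q).ne'

theorem contDiff_graphCurvature (hu : ContDiff ℝ ∞ u) : ContDiff ℝ ∞ (graphCurvature u) :=
  ContDiff.sum fun j _ => contDiff_pderiv j (contDiff_graphSlope hu j)

theorem contDiff_graphAccel (hu : ContDiff ℝ ∞ u) (k : Fin 2) : ContDiff ℝ ∞ (graphAccel u k) :=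
  ContDiff.sum fun i _ => (contDiff_graphSlope hu i).mul
    (contDiff_pderiv i (contDiff_graphSlope hu k))

theorem contDiff_graphMap (hu : ContDiff ℝ ∞ u) : ContDiff ℝ ∞ (graphMap u) := by
  rw [contDiff_piLp]
  intro k
  fin_cases k
  · exact (EuclideanSpace.proj 0 : Plane →L[ℝ] ℝ).contDiff
  · exact (EuclideanSpace.proj 1 : Plane →L[ℝ] ℝ).contDiff
  · exact hu

theorem contDiff_graphNormal (hu : ContDiff ℝ ∞ u) : ContDiff ℝ ∞ (graphNormal u) := by
  rw [contDiff_piLp]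
  intro k
  fin_cases k
  · exact (contDiff_graphSlope hu 0).neg
  · exact (contDiff_graphSlope hu 1).neg
  · exact contDiff_inv_graphDensity hu

theorem contDiffAt_graphGradient (hu : ContDiff ℝ ∞ u) (hf : ContDiffAt ℝ ∞ f q) (k : Fin 2) :
    ContDiffAt ℝ ∞ (graphGradient u f k) q :=
  (contDiffAt_pderiv k hf).sub ((contDiff_graphSlope hu k).contDiffAt.mul
    (ContDiffAt.sum fun l _ => (contDiff_graphSlope hu l).contDiffAt.mul (contDiffAt_pderiv l hf)))

theorem contDiffAt_graphFlow (hu : ContDiff ℝ ∞ u) (hf : ContDiffAt ℝ ∞ f q) (k : Fin 2) :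
    ContDiffAt ℝ ∞ (graphFlow u f k) q :=
  (contDiffAt_graphGradient hu hf k).div (contDiff_graphDensity hu).contDiffAt
    (graphDensity_pos u q).ne'

theorem pderiv_graphDensity (hu : ContDiff ℝ ∞ u) (k : Fin 2) (q : Plane) :
    pderiv k (graphDensity u) q = ∑ i, graphSlope u i q * pderiv k (pderiv i u) q := by
  have hd : ∀ i, DifferentiableAt ℝ (pderiv i u) q := fun i =>
    (contDiff_pderiv i hu).differentiable (by simp) q
  have hW : DifferentiableAt ℝ (graphDensity u) q :=
    (contDiff_graphDensity hu).differentiable (by simp) q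
  have h1 : pderiv k (fun q => graphDensity u q * graphDensity u q) q
      = pderiv k (fun q => 1 + (pderiv 0 u q * pderiv 0 u q + pderiv 1 u q * pderiv 1 u q)) q := by
    congr 1
    ext q
    rw [← sq, graphDensity_sq]; ring
  rw [pderiv_mul k hW hW, pderiv_add k (by fun_prop) (((hd 0).fun_mul (hd 0)).fun_add ((hd 1).fun_mul (hd 1))),
    pderiv_add k ((hd 0).fun_mul (hd 0)) ((hd 1).fun_mul (hd 1)), pderiv_mul k (hd 0) (hd 0),
    pderiv_mul k (hd 1) (hd 1)] at h1
  have h2 : pderiv k (fun _ => (1 : ℝ)) q = 0 := by simp [pderiv]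
  have h0 := (graphDensity_pos u q).ne'
  simp only [Fin.sum_univ_two, graphSlope]
  field_simp
  linarith

theorem pderiv_graphSlope (hu : ContDiff ℝ ∞ u) (k i : Fin 2) (q : Plane) :
    pderiv k (graphSlope u i) q * graphDensity u q
      + graphSlope u i q * pderiv k (graphDensity u) q = pderiv k (pderiv i u) q := by
  rw [← pderiv_mul k ((contDiff_graphSlope hu i).differentiable (by simp) q)
    ((contDiff_graphDensity hu).differentiable (by simp) q)]
  congr 1
  ext q
  exact graphSlope_mul u i q

/-- From `u_k = ν_k W` and the symmetry of the Hessian, `W ν_i ∂_i ν_k = ν_i u_ik - ν_k ν_i ∂_i W`,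
and the first term is `∂_k W`. -/
theorem graphAccel_mul (hu : ContDiff ℝ ∞ u) (k : Fin 2) (q : Plane) :
    graphAccel u k q * graphDensity u q = graphGradient u (graphDensity u) k q := by
  have h := fun i => pderiv_graphSlope hu i k q
  have h0 := pderiv_comm 0 k (hu.contDiffAt (x := q))
  have h1 := pderiv_comm 1 k (hu.contDiffAt (x := q))
  have hW := pderiv_graphDensity hu k q
  simp only [Fin.sum_univ_two, graphAccel, graphGradient] at *
  rw [hW, ← h0, ← h1, ← h 0, ← h 1]
  ring

theorem graphFlow_mul (hu : ContDiff ℝ ∞ u) (hf : DifferentiableAt ℝ f q) (k : Fin 2) :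
    graphFlow u (fun q => graphDensity u q * f q) k q
      = graphGradient u f k q + f q * graphAccel u k q := by
  have h := graphAccel_mul hu k q
  have h0 := (graphDensity_pos u q).ne'
  simp only [graphFlow, graphGradient, Fin.sum_univ_two, pderiv_mul _
    ((contDiff_graphDensity hu).differentiable (by simp) q) hf] at *
  rw [div_eq_iff h0]
  linear_combination (-f q) * h

/-- The inverse metric `1 - ν νᵀ` is symmetric, so the gradient can be moved from `W` to `f`. This
identifies the first-order term of the Laplacian of the graph. -/
theorem sum_graphAccel_mul_pderiv (hu : ContDiff ℝ ∞ u) (f : Plane → ℝ) (q : Plane) :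
    (∑ k, graphAccel u k q * pderiv k f q) * graphDensity u q
      = ∑ k, pderiv k (graphDensity u) q * graphGradient u f k q := by
  have h := fun k => graphAccel_mul hu k q
  simp only [graphGradient, Fin.sum_univ_two] at *
  linear_combination pderiv 0 f q * h 0 + pderiv 1 f q * h 1

/-- Here the potential of `L` arises: up to sign and conjugation `Dν` is the Weingarten map, so the
first sum is `|σ|²`, while the second differentiates the mean curvature along `ν`. -/
theorem divergence_graphAccel (hu : ContDiff ℝ ∞ u) (q : Plane) :
    ∑ k, pderiv k (graphAccel u k) q
      = (∑ i, ∑ j, pderiv j (graphSlope u i) q * pderiv i (graphSlope u j) q)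
        + ∑ i, graphSlope u i q * pderiv i (graphCurvature u) q := by
  have hs : ∀ i, DifferentiableAt ℝ (graphSlope u i) q := fun i =>
    (contDiff_graphSlope hu i).differentiable (by simp) q
  have hp : ∀ i j, DifferentiableAt ℝ (pderiv i (graphSlope u j)) q := fun i j =>
    (contDiff_pderiv i (contDiff_graphSlope hu j)).differentiable (by simp) q
  have hc := pderiv_comm 0 1 ((contDiff_graphSlope hu 0).contDiffAt (x := q))
  have hc' := pderiv_comm 0 1 ((contDiff_graphSlope hu 1).contDiffAt (x := q))
  have e1 : ∀ k, pderiv k (graphAccel u k) q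
      = pderiv k (fun q => graphSlope u 0 q * pderiv 0 (graphSlope u k) q
        + graphSlope u 1 q * pderiv 1 (graphSlope u k) q) q := fun k => by
    congr 1; ext q; simp [graphAccel]
  have e2 : ∀ i, pderiv i (graphCurvature u) q
      = pderiv i (fun q => pderiv 0 (graphSlope u 0) q + pderiv 1 (graphSlope u 1) q) q :=
    fun k => by congr 1; ext q; simp [graphCurvature]
  simp only [e1, e2, Fin.sum_univ_two, pderiv_add _ ((hs 0).fun_mul (hp 0 _)) ((hs 1).fun_mul (hp 1 _)),
    pderiv_add _ (hp 0 0) (hp 1 1), pderiv_mul _ (hs _) (hp _ _)]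
  rw [hc', hc]
  ring

/-- By `graphFlow_mul` the flow of `W f` is `∇f + f · graphAccel`. In its divergence the first two
sums form the Laplacian of `f` on the graph, and no other first-order term is left. -/
theorem divergence_graphFlow (hu : ContDiff ℝ ∞ u) (hf : ContDiffAt ℝ ∞ f q) :
    ∑ k, pderiv k (graphFlow u (fun q => graphDensity u q * f q) k) q
      = (∑ k, pderiv k (graphGradient u f k) q) + (∑ k, graphAccel u k q * pderiv k f q)
        + (∑ k, pderiv k (graphAccel u k) q) * f q := by
  have e : ∀ k, graphFlow u (fun q => graphDensity u q * f q) k =ᶠ[nhds q]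
      fun q => graphGradient u f k q + f q * graphAccel u k q := fun k => by
    filter_upwards [((hf.of_le (m := 1) (by simp)).eventually (by simp))] with q' hq'
    exact graphFlow_mul hu (hq'.differentiableAt (by simp)) k
  have hf' := hf.differentiableAt (by simp)
  have hg : ∀ k, DifferentiableAt ℝ (graphGradient u f k) q := fun k =>
    (contDiffAt_graphGradient hu hf k).differentiableAt (by simp)
  have ha : ∀ k, DifferentiableAt ℝ (graphAccel u k) q := fun k =>
    (contDiff_graphAccel hu k).differentiable (by simp) q
  simp only [pderiv_congr _ (e _), pderiv_add _ (hg _) (hf'.fun_mul (ha _)),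
    pderiv_mul _ hf' (ha _), Fin.sum_univ_two]
  ring

theorem graphFlow_nonneg (u g : Plane → ℝ) (q : Plane) :
    0 ≤ ∑ k, graphFlow u g k q * pderiv k g q := by
  have h := graphSlope_sq u q
  have hW := graphDensity_pos u q
  have h1 : ∑ k, graphFlow u g k q * pderiv k g q = (pderiv 0 g q ^ 2 + pderiv 1 g q ^ 2
      - (graphSlope u 0 q * pderiv 0 g q + graphSlope u 1 q * pderiv 1 g q) ^ 2)
        / graphDensity u q := by
    simp only [graphFlow, graphGradient, Fin.sum_univ_two]
    ring
  rw [h1]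
  refine div_nonneg ?_ hW.le
  -- Cauchy–Schwarz in the form of Lagrange's identity, together with `1 - |ν|² = 1/W²`.
  nlinarith [sq_nonneg (graphSlope u 0 q * pderiv 1 g q - graphSlope u 1 q * pderiv 0 g q),
    mul_nonneg (sq_nonneg (1 / graphDensity u q)) (add_nonneg (sq_nonneg (pderiv 0 g q))
      (sq_nonneg (pderiv 1 g q)))]

end Graph

/-! ### The geometry of a surface that is a graph -/

theorem contDiff_horizontal : ContDiff ℝ ∞ horizontal := by
  rw [contDiff_piLp]
  intro k
  fin_cases k
  · exact (EuclideanSpace.proj 0 : Space →L[ℝ] ℝ).contDiff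
  · exact (EuclideanSpace.proj 1 : Space →L[ℝ] ℝ).contDiff

section Pairing

variable {u : Plane → ℝ} {q : Plane}

theorem fderiv_apply_component {V : Plane → Space} (hV : DifferentiableAt ℝ V q) (i : Fin 2)
    (k : Fin 3) :
    fderiv ℝ V q (EuclideanSpace.single i 1) k = pderiv i (fun q => V q k) q := by
  have : HasFDerivAt (fun q => V q k) ((EuclideanSpace.proj k : Space →L[ℝ] ℝ).comp (fderiv ℝ V q))
      q := (EuclideanSpace.proj k : Space →L[ℝ] ℝ).hasFDerivAt.comp q hV.hasFDerivAt
  rw [pderiv, this.fderiv]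
  rfl

theorem inner_space (v w : Space) : inner ℝ v w = v 0 * w 0 + v 1 * w 1 + v 2 * w 2 := by
  simp [PiLp.inner_apply, Fin.sum_univ_three]
  ring

/-- The inner products of the partial derivatives of a vector field on the plane with the coordinate
tangent vectors of the graph. -/
theorem inner_fderiv_graphMap (hu : ContDiff ℝ ∞ u) {V : Plane → Space}
    (hV : DifferentiableAt ℝ V q) (i j : Fin 2) :
    inner ℝ (fderiv ℝ V q (EuclideanSpace.single i 1))
      (fderiv ℝ (graphMap u) q (EuclideanSpace.single j 1))
    = pderiv i (fun q => V q (j.castSucc)) q + pderiv i (fun q => V q 2) q * pderiv j u q := by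
  have h := fun k => fderiv_apply_component
    ((contDiff_graphMap hu).differentiable (by simp) q) j k
  have h0 : (fun q => graphMap u q 0) = fun q => q 0 := rfl
  have h1 : (fun q => graphMap u q 1) = fun q => q 1 := rfl
  have h2 : (fun q => graphMap u q 2) = u := rfl
  rw [inner_space, h, h, h, fderiv_apply_component hV, fderiv_apply_component hV,
    fderiv_apply_component hV, h0, h1, h2, pderiv_coord, pderiv_coord]
  fin_cases j <;> simp

theorem gramMatrix_graphMap (hu : ContDiff ℝ ∞ u) (q : Plane) :
    gramMatrix (fderiv ℝ (graphMap u) q)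
      = !![1 + pderiv 0 u q ^ 2, pderiv 0 u q * pderiv 1 u q;
          pderiv 0 u q * pderiv 1 u q, 1 + pderiv 1 u q ^ 2] := by
  have h := inner_fderiv_graphMap hu ((contDiff_graphMap hu).differentiable (by simp) q)
  have h0 : (fun q => graphMap u q 0) = fun q => q 0 := rfl
  have h1 : (fun q => graphMap u q 1) = fun q => q 1 := rfl
  have h2 : (fun q => graphMap u q 2) = u := rfl
  ext i j
  rw [gramMatrix, Matrix.of_apply, h, h2]
  fin_cases i <;> fin_cases j <;> simp [h0, h1, pderiv_coord] <;> ring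

theorem det_gramMatrix_graphMap (hu : ContDiff ℝ ∞ u) (q : Plane) :
    √(gramMatrix (fderiv ℝ (graphMap u) q)).det = graphDensity u q := by
  rw [gramMatrix_graphMap hu, Matrix.det_fin_two_of, graphDensity]
  congr 1
  ring

theorem inv_gramMatrix_graphMap (hu : ContDiff ℝ ∞ u) (q : Plane) :
    (gramMatrix (fderiv ℝ (graphMap u) q))⁻¹
      = !![1 - graphSlope u 0 q ^ 2, -(graphSlope u 0 q * graphSlope u 1 q);
          -(graphSlope u 0 q * graphSlope u 1 q), 1 - graphSlope u 1 q ^ 2] := by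
  have hW := graphDensity_sq u q
  have h := (graphDensity_pos u q).ne'
  refine Matrix.inv_eq_right_inv ?_
  rw [gramMatrix_graphMap hu, Matrix.mul_fin_two, Matrix.one_fin_two]
  simp only [graphSlope]
  congr 1
  ext i j
  fin_cases i <;> fin_cases j <;> simp <;> field_simp <;> rw [hW] <;> ring

theorem inv_gramMatrix_graphMap_apply (hu : ContDiff ℝ ∞ u) (q : Plane) (i j : Fin 2) :
    (gramMatrix (fderiv ℝ (graphMap u) q))⁻¹ i j
      = (if i = j then 1 else 0) - graphSlope u i q * graphSlope u j q := by
  rw [inv_gramMatrix_graphMap hu]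
  fin_cases i <;> fin_cases j <;> simp <;> ring

/-- The second fundamental form of the graph in coordinates. -/
theorem inner_fderiv_graphNormal (hu : ContDiff ℝ ∞ u) (q : Plane) (i j : Fin 2) :
    -inner ℝ (fderiv ℝ (graphNormal u) q (EuclideanSpace.single i 1))
      (fderiv ℝ (graphMap u) q (EuclideanSpace.single j 1))
    = pderiv i (pderiv j u) q / graphDensity u q := by
  have hW : DifferentiableAt ℝ (graphDensity u) q :=
    (contDiff_graphDensity hu).differentiable (by simp) q
  have hWi : DifferentiableAt ℝ (fun q => 1 / graphDensity u q) q :=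
    (contDiff_inv_graphDensity hu).differentiable (by simp) q
  have h0 := (graphDensity_pos u q).ne'
  have e1 : pderiv i (fun q => graphNormal u q j.castSucc) q = -pderiv i (graphSlope u j) q := by
    have : (fun q => graphNormal u q j.castSucc) = fun q => -graphSlope u j q := by
      ext q; fin_cases j <;> rfl
    rw [this, pderiv, pderiv, fderiv_fun_neg]
    rfl
  have e2 : pderiv i (fun q => graphNormal u q 2) q * graphDensity u q
      + 1 / graphDensity u q * pderiv i (graphDensity u) q = 0 := by
    have : (fun q => graphNormal u q 2) = fun q => 1 / graphDensity u q := rfl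
    rw [this, ← pderiv_mul i hWi hW]
    have : (fun q => 1 / graphDensity u q * graphDensity u q) = fun _ => (1 : ℝ) := by
      ext q; exact one_div_mul_cancel (graphDensity_pos u q).ne'
    rw [this]; simp [pderiv]
  rw [inner_fderiv_graphMap hu ((contDiff_graphNormal hu).differentiable (by simp) q), e1,
    ← pderiv_graphSlope hu, ← graphSlope_mul u j q, eq_div_iff h0]
  have e3 : pderiv i (graphDensity u) q
      = -(pderiv i (fun q => graphNormal u q 2) q * graphDensity u q) * graphDensity u q := by
    field_simp at e2
    linear_combination e2
  rw [e3]
  ring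

/-- The tangent vector field of the graph with given components. -/
noncomputable def tangentField (u : Plane → ℝ) (v : Fin 2 → Plane → ℝ) (q : Plane) : Space :=
  !₂[v 0 q, v 1 q, v 0 q * pderiv 0 u q + v 1 q * pderiv 1 u q]

theorem tangentField_eq_sum (hu : ContDiff ℝ ∞ u) (v : Fin 2 → Plane → ℝ) (q : Plane) :
    tangentField u v q = ∑ k, v k q • fderiv ℝ (graphMap u) q (EuclideanSpace.single k 1) := by
  have h := fun i k => fderiv_apply_component
    ((contDiff_graphMap hu).differentiable (by simp) q) i k
  have h0 : (fun q => graphMap u q 0) = fun q => q 0 := rfl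
  have h1 : (fun q => graphMap u q 1) = fun q => q 1 := rfl
  have h2 : (fun q => graphMap u q 2) = u := rfl
  ext k
  rw [Fin.sum_univ_two, PiLp.add_apply, PiLp.smul_apply, PiLp.smul_apply, h, h]
  fin_cases k
  · simp [tangentField, h0, pderiv_coord]
  · simp [tangentField, h1, pderiv_coord]
  · simp [tangentField, h2]

theorem differentiableAt_tangentField (hu : ContDiff ℝ ∞ u) {v : Fin 2 → Plane → ℝ}
    (hv : ∀ k, DifferentiableAt ℝ (v k) q) : DifferentiableAt ℝ (tangentField u v) q := by
  have hd : ∀ i, DifferentiableAt ℝ (pderiv i u) q := fun i =>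
    (contDiff_pderiv i hu).differentiable (by simp) q
  rw [differentiableAt_piLp]
  intro k
  fin_cases k
  · exact hv 0
  · exact hv 1
  · exact ((hv 0).mul (hd 0)).add ((hv 1).mul (hd 1))

/-- The divergence of a tangent vector field of the graph. -/
theorem divergence_tangentField (hu : ContDiff ℝ ∞ u) {v : Fin 2 → Plane → ℝ}
    (hv : ∀ k, DifferentiableAt ℝ (v k) q) :
    (∑ i, ∑ j, (gramMatrix (fderiv ℝ (graphMap u) q))⁻¹ i j
      * inner ℝ (fderiv ℝ (tangentField u v) q (EuclideanSpace.single i 1))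
        (fderiv ℝ (graphMap u) q (EuclideanSpace.single j 1))) * graphDensity u q
    = (∑ k, pderiv k (v k) q) * graphDensity u q + ∑ k, pderiv k (graphDensity u) q * v k q := by
  have hd : ∀ i, DifferentiableAt ℝ (pderiv i u) q := fun i =>
    (contDiff_pderiv i hu).differentiable (by simp) q
  have e0 : (fun q => tangentField u v q 0) = v 0 := rfl
  have e1 : (fun q => tangentField u v q 1) = v 1 := rfl
  have e2 : (fun q => tangentField u v q 2)
      = fun q => v 0 q * pderiv 0 u q + v 1 q * pderiv 1 u q := rfl
  have hc := pderiv_comm 0 1 (hu.contDiffAt (x := q))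
  -- After `∇u` is written as `W ν`, this is the only relation between `W` and `ν` that the identity
  -- needs.
  have hs : graphDensity u q ^ 2 * (1 - graphSlope u 0 q ^ 2 - graphSlope u 1 q ^ 2) = 1 := by
    have h := graphSlope_sq u q
    have h0 := (graphDensity_pos u q).ne'
    field_simp at h
    linear_combination -h
  simp only [inv_gramMatrix_graphMap_apply hu,
    inner_fderiv_graphMap hu (differentiableAt_tangentField hu hv), Fin.sum_univ_two, e2,
    pderiv_add _ ((hv 0).fun_mul (hd 0)) ((hv 1).fun_mul (hd 1)), pderiv_mul _ (hv _) (hd _),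
    pderiv_graphDensity hu, Fin.castSucc_zero, Fin.castSucc_one, e0, e1]
  rw [hc, ← graphSlope_mul u 0 q, ← graphSlope_mul u 1 q]
  simp only [Fin.isValue, ite_true, one_ne_zero, zero_ne_one, ite_false]
  linear_combination
    (((pderiv 0 (v 0) q * graphSlope u 0 q + pderiv 0 (v 1) q * graphSlope u 1 q) * graphDensity u q
      + v 0 q * pderiv 0 (pderiv 0 u) q + v 1 q * pderiv 1 (pderiv 0 u) q) * graphSlope u 0 q
    + ((pderiv 1 (v 0) q * graphSlope u 0 q + pderiv 1 (v 1) q * graphSlope u 1 q)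
      * graphDensity u q + v 0 q * pderiv 1 (pderiv 0 u) q + v 1 q * pderiv 1 (pderiv 1 u) q)
      * graphSlope u 1 q) * hs

/-- The matrix `G⁻¹S` of the graph is the derivative of `∇u / √(1 + |∇u|²)`. -/
theorem inv_gramMatrix_mul_hessian (hu : ContDiff ℝ ∞ u) (q : Plane) :
    (gramMatrix (fderiv ℝ (graphMap u) q))⁻¹
      * (Matrix.of fun i j => pderiv i (pderiv j u) q / graphDensity u q)
    = Matrix.of fun i j => pderiv j (graphSlope u i) q := by
  have h0 := (graphDensity_pos u q).ne'
  have hW := fun k => pderiv_graphDensity hu k q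
  have h := fun k i => pderiv_graphSlope hu k i q
  have hc := pderiv_comm 0 1 (hu.contDiffAt (x := q))
  ext i j
  have hc' : ∀ k, pderiv k (pderiv j u) q = pderiv j (pderiv k u) q := fun k =>
    pderiv_comm k j hu.contDiffAt
  simp only [Matrix.mul_apply, Matrix.of_apply, Fin.sum_univ_two, hc',
    inv_gramMatrix_graphMap_apply hu] at *
  rw [← mul_left_inj' h0]
  have hh : pderiv j (graphSlope u i) q * graphDensity u q
      = pderiv j (pderiv i u) q - graphSlope u i q * (graphSlope u 0 q * pderiv j (pderiv 0 u) q
        + graphSlope u 1 q * pderiv j (pderiv 1 u) q) := by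
    rw [← hW]; linear_combination h j i
  rw [hh]
  fin_cases i <;> simp <;> field_simp <;> ring

end Pairing

/-! ### Conjugation by the differential of a parametrization -/

section Conjugation

variable {B : Matrix (Fin 2) (Fin 2) ℝ}

/-- `B` is to be the differential of the projection in a chart of the surface. Bilinear forms change
by `Bᵀ · B`, so the endomorphism `G⁻¹ S` is conjugated and its trace invariants can be computed in
the coordinates of the plane. -/
theorem inv_conj_mul_conj (hB : B.det ≠ 0) (G S : Matrix (Fin 2) (Fin 2) ℝ) :
    (B.transpose * G * B)⁻¹ * (B.transpose * S * B) = B⁻¹ * (G⁻¹ * S) * B := by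
  have hB' : IsUnit B.transpose.det := by rw [Matrix.det_transpose]; exact hB.isUnit
  rw [Matrix.mul_inv_rev, Matrix.mul_inv_rev]
  simp only [Matrix.mul_assoc]
  rw [Matrix.nonsing_inv_mul_cancel_left _ _ hB']

theorem trace_conj (hB : B.det ≠ 0) (A : Matrix (Fin 2) (Fin 2) ℝ) :
    (B⁻¹ * A * B).trace = A.trace := by
  rw [Matrix.trace_mul_comm, ← Matrix.mul_assoc, Matrix.mul_nonsing_inv _ hB.isUnit,
    Matrix.one_mul]

theorem trace_conj_mul_conj (hB : B.det ≠ 0) (A : Matrix (Fin 2) (Fin 2) ℝ) :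
    ((B⁻¹ * A * B) * (B⁻¹ * A * B)).trace = (A * A).trace := by
  rw [← trace_conj hB (A * A)]
  congr 1
  simp only [Matrix.mul_assoc]
  rw [Matrix.mul_nonsing_inv_cancel_left _ _ hB.isUnit]

theorem sum_mul_eq_trace (A D : Matrix (Fin 2) (Fin 2) ℝ) :
    ∑ i, ∑ j, A i j * D i j = (A.transpose * D).trace := by
  simp [Matrix.trace, Matrix.mul_apply, Fin.sum_univ_two]
  ring

theorem sum_inv_conj_mul (hB : B.det ≠ 0) {G : Matrix (Fin 2) (Fin 2) ℝ} (hG : G.transpose = G)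
    (D : Matrix (Fin 2) (Fin 2) ℝ) :
    ∑ i, ∑ j, (B.transpose * G * B)⁻¹ i j * (B.transpose * D * B) i j
      = ∑ i, ∑ j, G⁻¹ i j * D i j := by
  rw [sum_mul_eq_trace, sum_mul_eq_trace, Matrix.transpose_nonsing_inv,
    Matrix.transpose_nonsing_inv, hG]
  have : (B.transpose * G * B).transpose = B.transpose * G * B := by
    simp [Matrix.transpose_mul, hG, Matrix.mul_assoc]
  rw [this, inv_conj_mul_conj hB, trace_conj hB]

theorem mul_inv_conj_mul (hB : B.det ≠ 0) (G : Matrix (Fin 2) (Fin 2) ℝ) :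
    B * (B.transpose * G * B)⁻¹ * B.transpose = G⁻¹ := by
  have hB' : IsUnit B.transpose.det := by rw [Matrix.det_transpose]; exact hB.isUnit
  rw [Matrix.mul_inv_rev, Matrix.mul_inv_rev, Matrix.mul_nonsing_inv_cancel_left _ _ hB.isUnit,
    Matrix.mul_assoc, Matrix.nonsing_inv_mul _ hB', Matrix.mul_one]

end Conjugation

/-! ### The graph as an immersed surface -/

section Surface

variable {M : Type*} [TopologicalSpace M] [ChartedSpace (EuclideanHalfSpace 2) M]

/-- The projection of an immersed surface to the horizontal plane. -/
noncomputable def projection (x : M → Space) (p : M) : Plane := horizontal (x p)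

/-- The differential of the projection to the horizontal plane. -/
noncomputable def projectionDeriv (x : M → Space) (p : M) : Plane →L[ℝ] Plane :=
  mfderiv (𝓡∂ 2) 𝓘(ℝ, Plane) (projection x) p

/-- An oriented immersed surface which is part of the graph of a smooth function. -/
structure IsGraphPart (u : Plane → ℝ) (x N : M → Space) : Prop where
  oriented : IsOrientedImmersion x N
  smooth : ContDiff ℝ ∞ u
  eq_graphMap : ∀ p, x p = graphMap u (projection x p)

theorem contMDiff_projection {x : M → Space} (hx : ContMDiff (𝓡∂ 2) 𝓘(ℝ, Space) ∞ x) :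
    ContMDiff (𝓡∂ 2) 𝓘(ℝ, Plane) ∞ (projection x) :=
  contDiff_horizontal.contMDiff.comp hx

/-- Equality is required only near `p`, because the planar form of a surface gradient is available
only where the function is differentiable. -/
theorem mfderiv_eq_comp {E : Type*} [NormedAddCommGroup E] [NormedSpace ℝ E] {x : M → Space}
    (hx : ContMDiff (𝓡∂ 2) 𝓘(ℝ, Space) ∞ x) {p : M} {V : M → E} {F : Plane → E}
    (hV : V =ᶠ[nhds p] F ∘ projection x) (hF : DifferentiableAt ℝ F (projection x p)) :
    (show Plane →L[ℝ] E from mfderiv (𝓡∂ 2) 𝓘(ℝ, E) V p)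
      = (fderiv ℝ F (projection x p)).comp (projectionDeriv x p) := by
  have h1 : MDifferentiableAt (𝓡∂ 2) 𝓘(ℝ, Plane) (projection x) p :=
    (contMDiff_projection hx).mdifferentiableAt (by simp)
  have h2 := hF.hasFDerivAt.hasMFDerivAt.comp p h1.hasMFDerivAt
  exact (h2.congr_of_eventuallyEq hV).mfderiv

variable {x N : M → Space} {u : Plane → ℝ}

theorem vecDeriv_eq (hx : ContMDiff (𝓡∂ 2) 𝓘(ℝ, Space) ∞ x) {p : M} {V : M → Space}
    {F : Plane → Space} (hV : V =ᶠ[nhds p] F ∘ projection x)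
    (hF : DifferentiableAt ℝ F (projection x p)) (i : Fin 2) :
    vecDeriv V p i
      = fderiv ℝ F (projection x p) (projectionDeriv x p (EuclideanSpace.single i 1)) := by
  rw [vecDeriv, mfderiv_eq_comp hx hV hF]
  rfl

theorem funDeriv_eq (hx : ContMDiff (𝓡∂ 2) 𝓘(ℝ, Space) ∞ x) {p : M} {f : M → ℝ}
    {F : Plane → ℝ} (hf : f =ᶠ[nhds p] F ∘ projection x)
    (hF : DifferentiableAt ℝ F (projection x p)) (i : Fin 2) :
    funDeriv f p i = ∑ k, planeMatrix (projectionDeriv x p) k i * pderiv k F (projection x p) := by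
  rw [funDeriv, mfderiv_eq_comp hx hf hF, ContinuousLinearMap.comp_apply, fderiv_apply_eq_pderiv]
  rfl

namespace IsGraphPart

variable (h : IsGraphPart u x N)
include h

theorem vecDeriv_x (p : M) (i : Fin 2) : vecDeriv x p i
    = fderiv ℝ (graphMap u) (projection x p)
      (projectionDeriv x p (EuclideanSpace.single i 1)) :=
  vecDeriv_eq h.oriented.smooth (Filter.Eventually.of_forall h.eq_graphMap)
    ((contDiff_graphMap h.smooth).differentiable (by simp) _) i

/-- The immersion factors through the projection by `graphMap u`, so there is no vertical tangent
vector. -/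
theorem projectionDeriv_injective (p : M) : Function.Injective (projectionDeriv x p) := by
  have h1 := mfderiv_eq_comp h.oriented.smooth (p := p)
    (Filter.Eventually.of_forall h.eq_graphMap)
    ((contDiff_graphMap h.smooth).differentiable (by simp) _)
  have h2 : Function.Injective
      ((fderiv ℝ (graphMap u) (projection x p)).comp (projectionDeriv x p)) := by
    rw [← h1]; exact h.oriented.immersion p
  rw [ContinuousLinearMap.coe_comp] at h2
  exact h2.of_comp

theorem det_planeMatrix_ne_zero (p : M) : (planeMatrix (projectionDeriv x p)).det ≠ 0 := by
  rw [det_planeMatrix]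
  intro h0
  have := LinearMap.bot_lt_ker_of_det_eq_zero h0
  rw [LinearMap.ker_eq_bot.2 (h.projectionDeriv_injective p)] at this
  exact lt_irrefl _ this

theorem pairing_eq {p : M} {V : M → Space} {F : Plane → Space}
    (hV : V =ᶠ[nhds p] F ∘ projection x) (hF : DifferentiableAt ℝ F (projection x p)) :
    (Matrix.of fun i j => inner ℝ (vecDeriv V p i) (vecDeriv x p j) : Matrix (Fin 2) (Fin 2) ℝ)
      = (planeMatrix (projectionDeriv x p)).transpose
        * (Matrix.of fun i j => inner ℝ
          (fderiv ℝ F (projection x p) (EuclideanSpace.single i 1))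
          (fderiv ℝ (graphMap u) (projection x p) (EuclideanSpace.single j 1)))
        * planeMatrix (projectionDeriv x p) := by
  rw [← pairing_comp]
  simp only [vecDeriv_eq h.oriented.smooth hV hF, h.vecDeriv_x]

theorem firstForm_eq (p : M) : firstForm x p
    = (planeMatrix (projectionDeriv x p)).transpose
      * gramMatrix (fderiv ℝ (graphMap u) (projection x p))
      * planeMatrix (projectionDeriv x p) :=
  h.pairing_eq (Filter.Eventually.of_forall h.eq_graphMap)
    ((contDiff_graphMap h.smooth).differentiable (by simp) _)

/-- The normal of a graph is one of the two unit normals of the graph. -/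
theorem normal_eq_smul (p : M) :
    N p = (N p 2 * graphDensity u (projection x p)) • graphNormal u (projection x p) := by
  have hsurj : Function.Surjective (projectionDeriv x p) :=
    LinearMap.surjective_of_injective (f := (projectionDeriv x p).toLinearMap)
      (h.projectionDeriv_injective p)
  have hn : ∀ v : Plane, inner ℝ (N p) (fderiv ℝ (graphMap u) (projection x p) v) = 0 := by
    intro v
    obtain ⟨w, rfl⟩ := hsurj v
    rw [clm_apply_eq_sum (projectionDeriv x p) w, map_sum, inner_sum]
    refine Finset.sum_eq_zero fun i _ => ?_
    rw [map_smul, inner_smul_right, ← h.vecDeriv_x, h.oriented.normal, mul_zero]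
  have hk := fun i k => fderiv_apply_component
    ((contDiff_graphMap h.smooth).differentiable (by simp) (projection x p)) i k
  have g0 : (fun q => graphMap u q 0) = fun q => q 0 := rfl
  have g1 : (fun q => graphMap u q 1) = fun q => q 1 := rfl
  have g2 : (fun q => graphMap u q 2) = u := rfl
  have h0 := hn (EuclideanSpace.single 0 1)
  have h1 := hn (EuclideanSpace.single 1 1)
  rw [inner_space, hk, hk, hk, g0, g1, g2, pderiv_coord, pderiv_coord,
    ← graphSlope_mul] at h0 h1
  simp at h0 h1
  have hW := (graphDensity_pos u (projection x p)).ne'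
  ext k
  fin_cases k
  · simp [graphNormal]; linear_combination h0
  · simp [graphNormal]; linear_combination h1
  · simp [graphNormal]; field_simp

theorem sq_normal_mul_density (p : M) : (N p 2 * graphDensity u (projection x p)) ^ 2 = 1 := by
  have h1 := congrArg norm (h.normal_eq_smul p)
  rw [norm_smul, norm_graphNormal, h.oriented.norm_normal, mul_one] at h1
  rw [← sq_abs, ← Real.norm_eq_abs, ← h1, one_pow]

end IsGraphPart

end Surface

section Operators

variable {M : Type*} [TopologicalSpace M] [ChartedSpace (EuclideanHalfSpace 2) M]
  {x N : M → Space} {u : Plane → ℝ}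

namespace IsGraphPart

variable (h : IsGraphPart u x N)
include h

theorem weingarten_eq {s : ℝ} (hN : ∀ p, N p = s • graphNormal u (projection x p)) (p : M) :
    weingarten x N p = (planeMatrix (projectionDeriv x p))⁻¹
      * (s • Matrix.of fun i j => pderiv j (graphSlope u i) (projection x p))
      * planeMatrix (projectionDeriv x p) := by
  have hν := (contDiff_graphNormal h.smooth).differentiable (by simp) (projection x p)
  have h1 := h.pairing_eq (p := p) (V := N) (F := fun q => s • graphNormal u q)
    (Filter.Eventually.of_forall hN) (hν.const_smul s)
  have h2 : secondForm x N p = (planeMatrix (projectionDeriv x p)).transpose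
      * (s • Matrix.of fun i j => pderiv i (pderiv j u) (projection x p)
        / graphDensity u (projection x p)) * planeMatrix (projectionDeriv x p) := by
    have : secondForm x N p = -Matrix.of fun i j => inner ℝ (vecDeriv N p i) (vecDeriv x p j) := rfl
    rw [this, h1, ← Matrix.neg_mul, ← Matrix.mul_neg]
    congr 2
    ext i j
    rw [Matrix.smul_apply, Matrix.neg_apply, Matrix.of_apply, Matrix.of_apply,
      ← inner_fderiv_graphNormal h.smooth, fderiv_fun_const_smul hν, smul_apply,
      inner_smul_left, smul_eq_mul, mul_neg]
    rfl
  rw [weingarten, h2, h.firstForm_eq, inv_conj_mul_conj (h.det_planeMatrix_ne_zero p),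
    Matrix.mul_smul, inv_gramMatrix_mul_hessian h.smooth]

theorem two_mul_meanCurvature {s : ℝ} (hN : ∀ p, N p = s • graphNormal u (projection x p))
    (p : M) : 2 * meanCurvature x N p = s * graphCurvature u (projection x p) := by
  rw [meanCurvature, h.weingarten_eq hN, trace_conj (h.det_planeMatrix_ne_zero p)]
  simp [Matrix.trace, graphCurvature, Fin.sum_univ_two]
  ring

theorem normSqSecondForm_eq {s : ℝ} (hs : s ^ 2 = 1)
    (hN : ∀ p, N p = s • graphNormal u (projection x p)) (p : M) :
    normSqSecondForm x N p = ∑ i, ∑ j, pderiv j (graphSlope u i) (projection x p)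
      * pderiv i (graphSlope u j) (projection x p) := by
  rw [normSqSecondForm, h.weingarten_eq hN, trace_conj_mul_conj (h.det_planeMatrix_ne_zero p),
    Matrix.smul_mul, Matrix.mul_smul, smul_smul, ← sq, hs, one_smul]
  simp [Matrix.trace, Matrix.mul_apply, Fin.sum_univ_two]

theorem surfaceGradient_eq {f : M → ℝ} {F : Plane → ℝ} (hf : ∀ p, f p = F (projection x p))
    {p : M} (hF : DifferentiableAt ℝ F (projection x p)) :
    surfaceGradient x f p = tangentField u (graphGradient u F) (projection x p) := by
  set B := planeMatrix (projectionDeriv x p) with hB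
  set G := gramMatrix (fderiv ℝ (graphMap u) (projection x p)) with hG
  have hinv := mul_inv_conj_mul (h.det_planeMatrix_ne_zero p) G
  rw [← hB] at hinv
  have hfd := funDeriv_eq h.oriented.smooth (Filter.Eventually.of_forall hf) hF
  have hsymm : (B.transpose * G * B)⁻¹ 1 0 = (B.transpose * G * B)⁻¹ 0 1 := by
    have hGs : G.transpose = G := transpose_gramMatrix _
    have : ((B.transpose * G * B)⁻¹).transpose = (B.transpose * G * B)⁻¹ := by
      rw [Matrix.transpose_nonsing_inv]
      simp [Matrix.transpose_mul, hGs, Matrix.mul_assoc]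
    exact congrFun (congrFun this 0) 1
  have hv : ∀ j, vecDeriv x p j = ∑ k, B k j •
      fderiv ℝ (graphMap u) (projection x p) (EuclideanSpace.single k 1) := fun j => by
    rw [h.vecDeriv_x, clm_apply_eq_sum]
    rfl
  rw [tangentField_eq_sum h.smooth, surfaceGradient, h.firstForm_eq, ← hB, ← hG]
  have hent := fun i j => congrFun (congrFun hinv i) j
  simp only [hG, inv_gramMatrix_graphMap_apply h.smooth] at hent
  rw [← hG] at hent
  generalize (B.transpose * G * B)⁻¹ = K at *
  simp only [Matrix.mul_apply, Matrix.transpose_apply, Fin.sum_univ_two] at hent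
  have hcoef : ∀ l, (∑ i, ∑ j, K i j * funDeriv f p i * B l j)
      = graphGradient u F l (projection x p) := fun l => by
    simp only [hfd, ← hB, Fin.sum_univ_two, graphGradient]
    have h0 := hent l 0
    have h1 := hent l 1
    rw [hsymm] at *
    fin_cases l <;> simp at * <;>
      linear_combination pderiv 0 F (projection x p) * h0 + pderiv 1 F (projection x p) * h1
  simp only [← hcoef, hv, Fin.sum_univ_two]
  module

theorem laplacian_mul_density {f : M → ℝ} {F : Plane → ℝ} (hf : ∀ p, f p = F (projection x p))
    {p : M} (hF : ContDiffAt ℝ ∞ F (projection x p)) :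
    laplacian x f p * graphDensity u (projection x p)
      = (∑ k, pderiv k (graphGradient u F k) (projection x p)) * graphDensity u (projection x p)
        + ∑ k, pderiv k (graphDensity u) (projection x p)
          * graphGradient u F k (projection x p) := by
  have hv : ∀ k, DifferentiableAt ℝ (graphGradient u F k) (projection x p) := fun k =>
    (contDiffAt_graphGradient h.smooth hF k).differentiableAt (by simp)
  -- The gradient is differentiated once more, so its planar form is needed on a neighbourhood of
  -- `p`.
  have hV : surfaceGradient x f
      =ᶠ[nhds p] tangentField u (graphGradient u F) ∘ projection x := by
    have hev := (contMDiff_projection h.oriented.smooth).continuous.continuousAt.eventually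
      ((hF.of_le (m := 1) (by simp)).eventually (by simp))
    filter_upwards [hev] with p' hp'
    exact h.surfaceGradient_eq hf (hp'.differentiableAt (by simp))
  have hp := h.pairing_eq hV (differentiableAt_tangentField h.smooth hv)
  have hp' := fun i j => congrFun (congrFun hp i) j
  simp only [Matrix.of_apply] at hp'
  rw [← divergence_tangentField h.smooth hv, laplacian, surfaceDivergence]
  congr 1
  simp only [hp', h.firstForm_eq]
  exact sum_inv_conj_mul (h.det_planeMatrix_ne_zero p) (transpose_gramMatrix _) _

/-- On a stationary surface that is a graph, the operator `L` is, up to the factor `√(1 + |∇u|²)`,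
in divergence form. -/
theorem jacobiOperator_eq {s : ℝ} (hs : s ^ 2 = 1)
    (hN : ∀ p, N p = s • graphNormal u (projection x p)) {a b : ℝ} {f : M → ℝ} {F : Plane → ℝ}
    (hf : ∀ p, f p = F (projection x p)) {p : M} (hF : ContDiffAt ℝ ∞ F (projection x p))
    (hH : ∀ᶠ q in nhds (projection x p), s * graphCurvature u q = a * (q 0 ^ 2 + q 1 ^ 2) + b) :
    jacobiOperator a x N f p
      = ∑ k, pderiv k (graphFlow u (fun q => graphDensity u q * F q) k) (projection x p) := by
  set q := projection x p with hq
  have hW := (graphDensity_pos u q).ne'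
  have hlap := h.laplacian_mul_density hf hF
  rw [← sum_graphAccel_mul_pderiv h.smooth, ← add_mul, mul_left_inj' hW] at hlap
  have hcurv : ∀ i, pderiv i (graphCurvature u) q = s * (2 * a * q i) := fun i => by
    have e : graphCurvature u =ᶠ[nhds q] fun q => s * (a * (q 0 ^ 2 + q 1 ^ 2) + b) := by
      filter_upwards [hH] with q' hq'
      rw [← hq', ← mul_assoc, ← sq, hs, one_mul]
    rw [pderiv_congr i e]
    have hc : ∀ j : Fin 2, HasFDerivAt (fun q : Plane => q j)
        (EuclideanSpace.proj j : Plane →L[ℝ] ℝ) q := fun j =>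
      (EuclideanSpace.proj j : Plane →L[ℝ] ℝ).hasFDerivAt
    have hd := (((((hc 0).pow 2).fun_add ((hc 1).pow 2)).const_mul a).add_const b).const_mul s
    rw [pderiv, hd.fderiv]
    fin_cases i <;> simp <;> left <;> ring
  have hx : x p = graphMap u q := h.eq_graphMap p
  -- Only the horizontal part of the support function remains. Hence the term `-2a(h - x₃N₃)` is
  -- exactly the derivative of `div ν = s (a r² + b)` along `ν`.
  have hinner : inner ℝ (N p) (x p) - x p 2 * N p 2
      = -s * (graphSlope u 0 q * q 0 + graphSlope u 1 q * q 1) := by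
    rw [inner_space, hN, ← hq, hx]
    simp [graphNormal, graphMap]
    ring
  rw [divergence_graphFlow h.smooth hF, jacobiOperator, hlap, hinner,
    h.normSqSecondForm_eq hs hN, divergence_graphAccel h.smooth, hf p]
  simp only [hcurv, Fin.sum_univ_two]
  ring

end IsGraphPart
end Operators

/-! ### Compact graphs -/

theorem integral_pderiv_eq_zero {F : Plane → ℝ} (hF : ContDiff ℝ 1 F) (hc : HasCompactSupport F)
    (i : Fin 2) : ∫ q, pderiv i F q = 0 := by
  have hd : Continuous (pderiv i F) := (hF.continuous_fderiv (by simp)).clm_apply continuous_const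
  have hcd : HasCompactSupport (pderiv i F) := hc.fderiv_apply ℝ _
  have hi : Integrable (fun q => fderiv ℝ F q (EuclideanSpace.single i 1)) :=
    hd.integrable_of_hasCompactSupport hcd
  have := integral_mul_fderiv_eq_neg_fderiv_mul_of_integrable (μ := (volume : Measure Plane))
    (f := fun _ => (1 : ℝ)) (g := F) (v := EuclideanSpace.single i 1) (by simp)
    (by simpa using hi) (by simpa using hF.continuous.integrable_of_hasCompactSupport hc)
    (fun _ _ => by fun_prop) (fun q _ => hF.differentiable (by simp) q)
  simp only [one_mul, fderiv_fun_const, Pi.zero_apply, zero_apply, zero_mul,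
    integral_zero, neg_zero] at this
  exact this

/-- Multiplication by a cut-off function; a function smooth on the whole plane makes `W`, `ν` and
the calibration smooth everywhere. -/
theorem exists_contDiff_eqOn {K U : Set Plane} (hK : IsClosed K) (hU : IsOpen U) (hKU : K ⊆ U)
    {u : Plane → ℝ} (hu : ContDiffOn ℝ ∞ u U) :
    ∃ v : Plane → ℝ, ContDiff ℝ ∞ v ∧ Set.EqOn v u K := by
  obtain ⟨V, hV, hKV, hVU⟩ := normal_exists_closure_subset hK hU hKU
  obtain ⟨χ, h1, h0, -⟩ := exists_contMDiffMap_one_nhds_of_subset_interior (n := ⊤)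
    𝓘(ℝ, Plane) hK (hKV.trans (hV.subset_interior_iff.2 subset_closure))
  have hχ : ContDiff ℝ ∞ χ := χ.contMDiff.contDiff
  refine ⟨fun q => χ q * u q, contDiff_iff_contDiffAt.2 fun q => ?_, fun q hq => ?_⟩
  · by_cases hq : q ∈ U
    · exact hχ.contDiffAt.mul (hu.contDiffAt (hU.mem_nhds hq))
    · have : (fun q => χ q * u q) =ᶠ[nhds q] fun _ => 0 := by
        filter_upwards [isClosed_closure.isOpen_compl.mem_nhds fun h => hq (hVU h)] with q' hq'
        rw [h0 q' hq', zero_mul]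
      exact contDiffAt_const.congr_of_eventuallyEq this
  · simp [h1.self_of_nhdsSet q hq]

section Surface

variable {M : Type*} [TopologicalSpace M] [ChartedSpace (EuclideanHalfSpace 2) M]

/-- A surface that is the graph over the closure of `Ω` of a smooth function on the plane; its
normal is `s` times the upward normal of the graph. -/
structure IsGraphSurface (Ω : Set Plane) (u : Plane → ℝ) (s : ℝ) (x N : M → Space) : Prop
    extends IsGraphPart u x N where
  injective : Function.Injective (projection x)
  range_eq : Set.range (projection x) = closure Ω
  isInteriorPoint : ∀ p, projection x p ∈ Ω → (𝓡∂ 2).IsInteriorPoint p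
  mem_boundary : ∀ p, projection x p ∉ Ω → p ∈ (𝓡∂ 2).boundary M
  sign_sq : s ^ 2 = 1
  normal_eq : ∀ p, N p = s • graphNormal u (projection x p)

theorem exists_isGraphSurface [IsManifold (𝓡∂ 2) ∞ M] [CompactSpace M] {Ω : Set Plane}
    (hΩ : IsOpen Ω) (hΩ' : IsConnected Ω) {x N : M → Space} (hx : IsOrientedImmersion x N)
    (hgraph : IsGraphOver Ω x) : ∃ u s, IsGraphSurface Ω u s x N := by
  obtain ⟨hinj, u₀, U, hU, hΩU, hu₀, hint, hbd⟩ := hgraph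
  obtain ⟨u, hu, huu⟩ := exists_contDiff_eqOn isClosed_closure hU hΩU hu₀
  have hproj : ∀ (p : M) (q : Plane), (!₂[q 0, q 1, u₀ q] : Space) = x p → projection x p = q := by
    intro p q hq
    rw [projection, ← hq]
    ext k
    fin_cases k <;> rfl
  have hcases : ∀ p : M, (p ∈ (𝓡∂ 2).interior M ∧ projection x p ∈ Ω ∨
      p ∈ (𝓡∂ 2).boundary M ∧ projection x p ∈ frontier Ω) ∧
      x p = !₂[projection x p 0, projection x p 1, u₀ (projection x p)] := by
    intro p
    by_cases hp : p ∈ (𝓡∂ 2).interior M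
    · obtain ⟨q, hq, hqp⟩ := hint.subset ⟨p, hp, rfl⟩
      rw [hproj p q hqp]
      exact ⟨Or.inl ⟨hp, hq⟩, hqp.symm⟩
    · have hp' : p ∈ (𝓡∂ 2).boundary M := by rwa [← ModelWithCorners.compl_interior]
      obtain ⟨q, hq, hqp⟩ := hbd.subset ⟨p, hp', rfl⟩
      rw [hproj p q hqp]
      exact ⟨Or.inr ⟨hp', hq⟩, hqp.symm⟩
  have hmem : ∀ p : M, projection x p ∈ closure Ω := fun p => by
    rcases (hcases p).1 with h | h
    · exact subset_closure h.2
    · exact frontier_subset_closure h.2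
  have hpart : IsGraphPart u x N := ⟨hx, hu, fun p => by
    rw [graphMap, huu (hmem p)]; exact (hcases p).2⟩
  have hpinj : Function.Injective (projection x) := fun p p' h => hinj (by
    rw [(hcases p).2, (hcases p').2, h])
  have hrange : Set.range (projection x) = closure Ω := by
    refine Set.Subset.antisymm (Set.range_subset_iff.2 hmem) fun q hq => ?_
    rw [closure_eq_self_union_frontier] at hq
    rcases hq with hq | hq
    · obtain ⟨p, -, hp⟩ := hint.symm.subset ⟨q, hq, rfl⟩
      exact ⟨p, hproj p q hp.symm⟩
    · obtain ⟨p, -, hp⟩ := hbd.symm.subset ⟨q, hq, rfl⟩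
      exact ⟨p, hproj p q hp.symm⟩
  have hcont : Continuous (projection x) := (contMDiff_projection hx.smooth).continuous
  -- The projection is a homeomorphism of `M` onto the connected set `closure Ω`; hence `N₃ W`,
  -- whose square is one, has constant sign.
  have hconn : IsPreconnected (Set.univ : Set M) := by
    rw [← (hcont.isClosedEmbedding hpinj).isInducing.isPreconnected_image, Set.image_univ, hrange]
    exact hΩ'.isPreconnected.closure
  have hsign := hconn.eq_or_eq_neg_of_sq_eq
    (f := fun p => N p 2 * graphDensity u (projection x p)) (g := fun _ => (1 : ℝ))
    (Continuous.continuousOn (((EuclideanSpace.proj 2 : Space →L[ℝ] ℝ).continuous.comp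
      hx.smooth_normal.continuous).mul ((contDiff_graphDensity hu).continuous.comp hcont)))
    continuousOn_const (fun p _ => by simpa using hpart.sq_normal_mul_density p) (by simp)
  have hdisj : ∀ q ∈ Ω, q ∉ frontier Ω := fun q hq hq' => by
    rw [hΩ.frontier_eq] at hq'; exact hq'.2 hq
  have hsurf : ∀ s : ℝ, s ^ 2 = 1 → (∀ p, N p 2 * graphDensity u (projection x p) = s) →
      IsGraphSurface Ω u s x N := fun s hs hN => ⟨hpart, hpinj, hrange, fun p hp => by
        rcases (hcases p).1 with h | h
        · exact h.1
        · exact absurd h.2 (hdisj _ hp), fun p hp => by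
        rcases (hcases p).1 with h | h
        · exact absurd h.2 hp
        · exact h.1, hs, fun p => by rw [← hN p]; exact hpart.normal_eq_smul p⟩
  rcases hsign with h | h
  · exact ⟨u, 1, hsurf 1 (by norm_num) fun p => h (Set.mem_univ p)⟩
  · exact ⟨u, -1, hsurf (-1) (by norm_num) fun p => h (Set.mem_univ p)⟩

namespace IsGraphSurface

variable {Ω : Set Plane} {u : Plane → ℝ} {s : ℝ} {x N : M → Space}

theorem continuous_projection (h : IsGraphSurface Ω u s x N) : Continuous (projection x) :=
  (contMDiff_projection h.oriented.smooth).continuous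

theorem curvature_eq (h : IsGraphSurface Ω u s x N) {a b : ℝ}
    (hH : ∀ p, 2 * meanCurvature x N p = a * radiusSq (x p) + b) {q : Plane} (hq : q ∈ closure Ω) :
    s * graphCurvature u q = a * (q 0 ^ 2 + q 1 ^ 2) + b := by
  rw [← h.range_eq] at hq
  obtain ⟨p, rfl⟩ := hq
  rw [← h.two_mul_meanCurvature h.normal_eq, hH]
  rfl

theorem measurable_density (h : IsGraphSurface Ω u s x N) :
    Measurable fun q => ENNReal.ofReal (graphDensity u q) :=
  (contDiff_graphDensity h.smooth).continuous.measurable.ennreal_ofReal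

section Area

variable [MeasurableSpace M] [BorelSpace M]

theorem chartArea_eq [IsManifold (𝓡∂ 2) ∞ M] (h : IsGraphSurface Ω u s x N) (p : M) {A : Set M} (hA : MeasurableSet A)
    (hp : A ⊆ (extChartAt (𝓡∂ 2) p).source) :
    chartArea x p A = ∫⁻ q in projection x '' A, ENNReal.ofReal (graphDensity u q) := by
  set φ := extChartAt (𝓡∂ 2) p
  have hT : ∀ z ∈ φ.target, HasFDerivWithinAt (projection x ∘ φ.symm)
      (fderivWithin ℝ (projection x ∘ φ.symm) (Set.range (𝓡∂ 2)) z) (Set.range (𝓡∂ 2)) z :=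
    fun z hz => ((contDiffWithinAt_comp_extChartAt_symm (contMDiff_projection h.oriented.smooth) p
      hz).differentiableWithinAt (by simp)).hasFDerivWithinAt
  rw [chartArea_eq_lintegral_image x p hA (T := projection x ∘ φ.symm)
    (ρ := graphDensity u) fun z hz => hT z hz.2]
  · congr 2
    rw [Set.image_comp]
    congr 1
    ext w
    constructor
    · rintro ⟨z, hz, rfl⟩
      exact hz.1
    · intro hw
      exact ⟨φ w, ⟨by rw [Set.mem_preimage, φ.left_inv (hp hw)]; exact hw, φ.map_source (hp hw)⟩,
        φ.left_inv (hp hw)⟩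
  · exact h.injective.comp_injOn (φ.symm.injOn.mono Set.inter_subset_right)
  · intro z hz
    have hX : HasFDerivAt (graphMap u) _ ((projection x ∘ φ.symm) z) :=
      ((contDiff_graphMap h.smooth).differentiable (by simp) _).hasFDerivAt
    have hc := hX.comp_hasFDerivWithinAt z (hT z hz.2)
    have he : x ∘ φ.symm = graphMap u ∘ (projection x ∘ φ.symm) := by
      ext1 w; exact h.eq_graphMap _
    rw [chartGram_eq, he, hc.fderivWithin
      ((𝓡∂ 2).uniqueDiffOn z (extChartAt_target_subset_modelRange p hz.2)),
      sqrt_det_gramMatrix_comp, det_gramMatrix_graphMap h.smooth]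

variable [CompactSpace M]

theorem measurableEmbedding (h : IsGraphSurface Ω u s x N) : MeasurableEmbedding (projection x) :=
  (h.continuous_projection.isClosedEmbedding h.injective).measurableEmbedding

variable [IsManifold (𝓡∂ 2) ∞ M]

/-- The two measures agree on the source of each chart, and finitely many charts cover `M`. -/
theorem areaMeasure_eq (h : IsGraphSurface Ω u s x N) : areaMeasure x =
    (volume.withDensity fun q => ENNReal.ofReal (graphDensity u q)).comap (projection x) := by
  obtain ⟨t, ht⟩ := isCompact_univ.elim_finite_subcover
    (fun p : M => (extChartAt (𝓡∂ 2) p).source) (fun p => isOpen_extChartAt_source p)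
    (fun p _ => Set.mem_iUnion.2 ⟨p, mem_extChartAt_source p⟩)
  have hcover : (⋃ p : t, (extChartAt (𝓡∂ 2) (p : M)).source) = Set.univ := by
    rw [Set.eq_univ_iff_forall]
    intro w
    obtain ⟨p, hp⟩ := Set.mem_iUnion.1 (ht (Set.mem_univ w))
    obtain ⟨hpt, hw⟩ := Set.mem_iUnion.1 hp
    exact Set.mem_iUnion.2 ⟨⟨p, hpt⟩, hw⟩
  rw [← Measure.restrict_univ (μ := areaMeasure x),
    ← Measure.restrict_univ (μ := Measure.comap _ _), ← hcover, Measure.restrict_iUnion_congr]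
  intro p
  ext A hA
  have hA' := hA.inter (isOpen_extChartAt_source (I := 𝓡∂ 2) (p : M)).measurableSet
  rw [Measure.restrict_apply hA, Measure.restrict_apply hA,
    areaMeasure_apply h.oriented.smooth p hA' Set.inter_subset_right,
    h.chartArea_eq p hA' Set.inter_subset_right, h.measurableEmbedding.comap_apply,
    withDensity_apply _ (h.measurableEmbedding.measurableSet_image.2 hA')]

theorem map_areaMeasure (h : IsGraphSurface Ω u s x N) : (areaMeasure x).map (projection x) =
    (volume.restrict (closure Ω)).withDensity fun q => ENNReal.ofReal (graphDensity u q) := by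
  rw [h.areaMeasure_eq, h.measurableEmbedding.map_comap, h.range_eq,
    restrict_withDensity isClosed_closure.measurableSet]

/-- Integrals over a graph are integrals over the closure of its domain. -/
theorem integral_eq (h : IsGraphSurface Ω u s x N) (F : Plane → ℝ) :
    ∫ p, F (projection x p) ∂(areaMeasure x) = ∫ q in closure Ω, graphDensity u q * F q := by
  rw [← h.measurableEmbedding.integral_map, h.map_areaMeasure,
    integral_withDensity_eq_integral_toReal_smul h.measurable_density (by simp)]
  simp only [ENNReal.toReal_ofReal (graphDensity_pos u _).le, smul_eq_mul]

theorem integrable_iff (h : IsGraphSurface Ω u s x N) (F : Plane → ℝ) :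
    Integrable (fun p => F (projection x p)) (areaMeasure x)
      ↔ IntegrableOn (fun q => graphDensity u q * F q) (closure Ω) := by
  have := h.measurableEmbedding.integrable_map_iff (μ := areaMeasure x) (g := F)
  change _ ↔ Integrable (fun p => F (projection x p)) (areaMeasure x) at this
  rw [← this, h.map_areaMeasure,
    integrable_withDensity_iff_integrable_smul' h.measurable_density (by simp)]
  simp only [ENNReal.toReal_ofReal (graphDensity_pos u _).le, smul_eq_mul, IntegrableOn]

end Area

/-- A smooth function on a graph is smooth as a function on the domain of the graph. -/
theorem contDiffAt_extend [IsManifold (𝓡∂ 2) ∞ M] (h : IsGraphSurface Ω u s x N) {f : M → ℝ}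
    (hf : ContMDiff (𝓡∂ 2) 𝓘(ℝ, ℝ) ∞ f) {q : Plane} (hq : q ∈ Ω) :
    ContDiffAt ℝ ∞ (Function.extend (projection x) f 0) q := by
  obtain ⟨p, rfl⟩ : q ∈ Set.range (projection x) := by
    rw [h.range_eq]; exact subset_closure hq
  set φ := extChartAt (𝓡∂ 2) p
  have hz : φ p ∈ φ.target := mem_extChartAt_target p
  -- Over `Ω` there are only interior points, where derivatives within the half-plane are ordinary
  -- derivatives and the inverse function theorem applies.
  have hnhds : Set.range (𝓡∂ 2) ∈ nhds (φ p) :=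
    mem_interior_iff_mem_nhds.1 (h.isInteriorPoint p hq)
  have hg : ContDiffAt ℝ ∞ (projection x ∘ φ.symm) (φ p) :=
    (contDiffWithinAt_comp_extChartAt_symm (contMDiff_projection h.oriented.smooth) p
      hz).contDiffAt hnhds
  have hfφ : ContDiffAt ℝ ∞ (f ∘ φ.symm) (φ p) :=
    (contDiffWithinAt_comp_extChartAt_symm hf p hz).contDiffAt hnhds
  have hder : fderiv ℝ (projection x ∘ φ.symm) (φ p) = projectionDeriv x p := by
    have hm : MDifferentiableAt (𝓡∂ 2) 𝓘(ℝ, Plane) (projection x) p :=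
      (contMDiff_projection h.oriented.smooth).mdifferentiableAt (by simp)
    rw [projectionDeriv, hm.mfderiv, fderivWithin_of_mem_nhds hnhds]
    rfl
  have hinj := h.projectionDeriv_injective p
  have hsurj : Function.Surjective (projectionDeriv x p) :=
    LinearMap.surjective_of_injective (f := (projectionDeriv x p).toLinearMap) hinj
  have hg' : HasFDerivAt (projection x ∘ φ.symm)
      (ContinuousLinearEquiv.ofBijective (projectionDeriv x p) (LinearMap.ker_eq_bot.2 hinj)
        (LinearMap.range_eq_top.2 hsurj) : Plane →L[ℝ] Plane) (φ p) := by
    rw [ContinuousLinearEquiv.coe_ofBijective, ← hder]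
    exact (hg.differentiableAt (by simp)).hasFDerivAt
  have hq' : (projection x ∘ φ.symm) (φ p) = projection x p := by
    rw [Function.comp_apply, φ.left_inv (mem_extChartAt_source p)]
  have hτ := hg.to_localInverse hg' (by simp)
  have hτ0 := hg.localInverse_apply_image hg' (by simp)
  have hev := (hg.hasStrictFDerivAt' hg' (by simp)).eventually_right_inverse
  rw [hq'] at hτ hτ0 hev
  -- As the projection is globally injective, the extension coincides near `q` with `f` composed
  -- with the local inverse of the projection.
  refine ContDiffAt.congr_of_eventuallyEq (f := (f ∘ φ.symm) ∘ hg.localInverse hg' (by simp))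
    (ContDiffAt.comp _ (by rw [hτ0]; exact hfφ) hτ) ?_
  filter_upwards [hev] with q' hq'
  conv_lhs => rw [← hq']
  exact h.injective.extend_apply f 0 _

end IsGraphSurface

end Surface

/-! ### Strong stability of graphs -/

/-- A smooth nondecreasing function that vanishes near zero; as `n` tends to infinity, it tends to
the identity. -/
noncomputable def cutoffId (n : ℕ) (t : ℝ) : ℝ := Real.smoothTransition (n * t ^ 2 - 1) * t

theorem contDiff_cutoffId (n : ℕ) : ContDiff ℝ ∞ (cutoffId n) :=
  (Real.smoothTransition.contDiff.comp
    ((contDiff_const.mul (contDiff_id.pow 2)).sub contDiff_const)).mul contDiff_id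

theorem cutoffId_of_le {n : ℕ} {t : ℝ} (h : n * t ^ 2 ≤ 1) : cutoffId n t = 0 := by
  rw [cutoffId, Real.smoothTransition.zero_of_nonpos (by linarith), zero_mul]

theorem abs_smoothTransition_le_one (t : ℝ) : |Real.smoothTransition t| ≤ 1 := by
  rw [abs_of_nonneg (Real.smoothTransition.nonneg t)]
  exact Real.smoothTransition.le_one t

theorem monotone_cutoffId (n : ℕ) : Monotone (cutoffId n) := by
  have hn : (0 : ℝ) ≤ n := n.cast_nonneg
  have key : ∀ {s t : ℝ}, 0 ≤ s → s ≤ t → cutoffId n s ≤ cutoffId n t := fun hs hst =>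
    mul_le_mul (Real.smoothTransition.monotone (sub_le_sub_right
      (mul_le_mul_of_nonneg_left (pow_le_pow_left₀ hs hst 2) hn) 1)) hst hs
      (Real.smoothTransition.nonneg _)
  -- The transition factor is even, so monotonicity on the nonnegative half-line suffices.
  have hodd : ∀ t, cutoffId n (-t) = -cutoffId n t := fun t => by simp [cutoffId]
  have h0 : cutoffId n 0 = 0 := by simp [cutoffId]
  intro s t hst
  rcases le_total 0 s with hs | hs
  · exact key hs hst
  · rcases le_total 0 t with ht | ht
    · have h1 := key le_rfl ht
      have h2 := key le_rfl (neg_nonneg.2 hs)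
      rw [hodd] at h2
      linarith
    · have h1 := key (neg_nonneg.2 ht) (neg_le_neg hst)
      rw [hodd, hodd] at h1
      linarith

theorem deriv_cutoffId_nonneg (n : ℕ) (t : ℝ) : 0 ≤ deriv (cutoffId n) t :=
  (monotone_cutoffId n).deriv_nonneg

theorem tendsto_smoothTransition_mul (t c : ℝ) :
    Filter.Tendsto (fun n : ℕ => Real.smoothTransition (n * t ^ 2 - 1) * (t * c)) Filter.atTop
      (nhds (t * c)) := by
  rcases eq_or_ne t 0 with rfl | ht
  · simp
  · obtain ⟨n₀, hn₀⟩ := exists_nat_ge (2 / t ^ 2)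
    refine tendsto_const_nhds.congr' ?_
    filter_upwards [Filter.eventually_ge_atTop n₀] with n hn
    have ht2 : 0 < t ^ 2 := by positivity
    have h1 : 2 / t ^ 2 ≤ n := hn₀.trans (by exact_mod_cast hn)
    rw [div_le_iff₀ ht2] at h1
    rw [Real.smoothTransition.one_of_one_le (by linarith), one_mul]

section Planar

variable {Ω : Set Plane} {u g : Plane → ℝ}

/-- The integral of `-η'(g) ⟨A∇g, ∇g⟩ ≤ 0` in divergence form, for a cut-off `η(g)` of a function `g`
on a domain that tends to zero at the boundary. -/
theorem integral_cutoff_mul_divergence_le (hu : ContDiff ℝ ∞ u)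
    (hg : ∀ q ∈ Ω, ContDiffAt ℝ ∞ g q) (n : ℕ) {K : Set Plane} (hK : IsCompact K) (hKΩ : K ⊆ Ω)
    (hgK : ∀ q ∉ K, cutoffId n (g q) = 0) {L : Plane → ℝ}
    (hL : ∀ q ∈ Ω, L q = ∑ k, pderiv k (graphFlow u g k) q)
    (hint : IntegrableOn (fun q => cutoffId n (g q) * L q) (closure Ω)) :
    ∫ q in closure Ω, cutoffId n (g q) * L q ≤ 0 := by
  set X : Fin 2 → Plane → ℝ := fun k q => cutoffId n (g q) * graphFlow u g k q with hX
  have hη : ∀ q ∈ Ω, ContDiffAt ℝ ∞ (fun q => cutoffId n (g q)) q := fun q hq =>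
    (contDiff_cutoffId n).contDiffAt.comp q (hg q hq)
  have hzero : ∀ k, ∀ q ∉ K, X k =ᶠ[nhds q] fun _ => 0 := fun k q hq => by
    filter_upwards [hK.isClosed.isOpen_compl.mem_nhds hq] with q' hq'
    simp only [hX, hgK q' hq', zero_mul]
  have hXs : ∀ k, ContDiff ℝ ∞ (X k) := fun k => contDiff_iff_contDiffAt.2 fun q => by
    by_cases hq : q ∈ Ω
    · exact (hη q hq).mul (contDiffAt_graphFlow hu (hg q hq) k)
    · exact contDiffAt_const.congr_of_eventuallyEq (hzero k q fun h => hq (hKΩ h))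
  have hXc : ∀ k, HasCompactSupport (X k) := fun k => HasCompactSupport.intro hK fun q hq =>
    (hzero k q hq).eq_of_nhds
  have hpz : ∀ k, ∀ q ∉ K, pderiv k (X k) q = 0 := fun k q hq => by
    rw [pderiv_congr k (hzero k q hq)]; simp [pderiv]
  have hpi : ∀ k, Integrable (pderiv k (X k)) := fun k =>
    (contDiff_pderiv k (hXs k)).continuous.integrable_of_hasCompactSupport
      ((hXc k).fderiv_apply ℝ _)
  -- On `Ω` the difference of the two sides is `η'(g) ⟨A∇g, ∇g⟩ ≥ 0`; on the rest of `closure Ω`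
  -- both vanish, since such points lie outside `K`.
  have hle : ∀ q ∈ closure Ω, cutoffId n (g q) * L q ≤ ∑ k, pderiv k (X k) q := fun q _ => by
    by_cases hq : q ∈ Ω
    · have hflow : ∀ k, DifferentiableAt ℝ (graphFlow u g k) q := fun k =>
        (contDiffAt_graphFlow hu (hg q hq) k).differentiableAt (by simp)
      have hch : ∀ k, pderiv k (fun q => cutoffId n (g q)) q
          = deriv (cutoffId n) (g q) * pderiv k g q := fun k => by
        have h1 : HasDerivAt (cutoffId n) (deriv (cutoffId n) (g q)) (g q) :=
          ((contDiff_cutoffId n).differentiable (by simp) _).hasDerivAt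
        have h2 := ((hg q hq).differentiableAt (by simp)).hasFDerivAt
        have h3 : HasFDerivAt (fun q => cutoffId n (g q)) _ q := h1.comp_hasFDerivAt q h2
        rw [pderiv, h3.fderiv]
        rfl
      have hprod : ∀ k, pderiv k (X k) q = deriv (cutoffId n) (g q) * pderiv k g q
          * graphFlow u g k q + cutoffId n (g q) * pderiv k (graphFlow u g k) q := fun k => by
        rw [← hch, ← pderiv_mul k ((hη q hq).differentiableAt (by simp)) (hflow k)]
      rw [hL q hq, Fin.sum_univ_two, Fin.sum_univ_two, hprod, hprod]
      have := mul_nonneg (deriv_cutoffId_nonneg n (g q)) (graphFlow_nonneg u g q)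
      rw [Fin.sum_univ_two] at this
      linarith
    · have hqK : q ∉ K := fun h => hq (hKΩ h)
      simp [hgK q hqK, hpz _ q hqK]
  calc _ ≤ ∫ q in closure Ω, ∑ k, pderiv k (X k) q :=
        setIntegral_mono_on hint (integrable_finsetSum _ fun k _ => (hpi k).integrableOn)
          isClosed_closure.measurableSet hle
    _ = ∫ q, ∑ k, pderiv k (X k) q := setIntegral_eq_integral_of_forall_compl_eq_zero
        fun q hq => Finset.sum_eq_zero fun k _ =>
          hpz k q fun h => hq (subset_closure (hKΩ h))
    _ = 0 := by
        rw [integral_finsetSum _ fun k _ => hpi k]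
        exact Finset.sum_eq_zero fun k _ => integral_pderiv_eq_zero
          ((hXs k).of_le (by simp)) (hXc k) k

end Planar

section Surface

variable {M : Type*} [TopologicalSpace M] [ChartedSpace (EuclideanHalfSpace 2) M]
  [IsManifold (𝓡∂ 2) ∞ M] [CompactSpace M] [MeasurableSpace M] [BorelSpace M]
  {Ω : Set Plane} {u : Plane → ℝ} {s : ℝ} {x N : M → Space}

theorem IsGraphSurface.isStronglyStable (h : IsGraphSurface Ω u s x N) (hΩ : IsOpen Ω) {a b : ℝ}
    (hH : ∀ p, 2 * meanCurvature x N p = a * radiusSq (x p) + b) : IsStronglyStable a x N := by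
  intro f hf hf0
  rw [Left.nonneg_neg_iff]
  -- Integrability is needed only for dominated convergence, so it may be assumed.
  by_cases hfi : Integrable (fun p => f p * jacobiOperator a x N f p) (areaMeasure x)
  swap
  · rw [integral_undef hfi]
  -- Functions on `M` are carried to the plane, with value zero off `closure Ω`; the frontier values
  -- of `L` need no continuity.
  set F := Function.extend (projection x) f 0 with hFdef
  set L := Function.extend (projection x) (jacobiOperator a x N f) 0
  have hF : ∀ p, f p = F (projection x p) := fun p => (h.injective.extend_apply f 0 p).symm
  have hLp : ∀ p, jacobiOperator a x N f p = L (projection x p) :=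
    fun p => (h.injective.extend_apply _ 0 p).symm
  have hFs : ∀ q ∈ Ω, ContDiffAt ℝ ∞ F q := fun q hq => h.contDiffAt_extend hf hq
  set g : Plane → ℝ := fun q => graphDensity u q * F q with hgdef
  have hgs : ∀ q ∈ Ω, ContDiffAt ℝ ∞ g q := fun q hq =>
    (contDiff_graphDensity h.smooth).contDiffAt.mul (hFs q hq)
  have hL : ∀ q ∈ Ω, L q = ∑ k, pderiv k (graphFlow u g k) q := fun q hq => by
    obtain ⟨p, rfl⟩ : q ∈ Set.range (projection x) := by
      rw [h.range_eq]; exact subset_closure hq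
    rw [← hLp]
    refine h.jacobiOperator_eq h.sign_sq h.normal_eq hF (hFs _ hq) (b := b) ?_
    filter_upwards [hΩ.mem_nhds hq] with q' hq'
    exact h.curvature_eq hH (subset_closure hq')
  have hfactor : ∀ q, graphDensity u q * (F q * L q) = g q * L q := fun q => by
    simp only [hgdef]; ring
  simp only [hF, hLp] at hfi ⊢
  have hint : IntegrableOn (fun q => g q * L q) (closure Ω) := by
    simpa only [hfactor] using (h.integrable_iff fun q => F q * L q).1 hfi
  rw [h.integral_eq fun q => F q * L q]
  simp only [hfactor]
  have hcontg : Continuous fun p => graphDensity u (projection x p) * f p :=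
    ((contDiff_graphDensity h.smooth).continuous.comp h.continuous_projection).mul hf.continuous
  have hgm : Measurable g := (contDiff_graphDensity h.smooth).continuous.measurable.mul
    (h.measurableEmbedding.measurable_extend hf.continuous.measurable measurable_zero)
  have hθm : ∀ n : ℕ, Measurable fun q => Real.smoothTransition (n * g q ^ 2 - 1) := fun n =>
    Real.smoothTransition.continuous.measurable.comp
      (((hgm.pow_const 2).const_mul (n : ℝ)).sub_const 1)
  have hθi : ∀ n : ℕ, IntegrableOn
      (fun q => Real.smoothTransition (n * g q ^ 2 - 1) * (g q * L q)) (closure Ω) := fun n =>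
    Integrable.bdd_mul hint (hθm n).aestronglyMeasurable
      (Filter.Eventually.of_forall fun q => abs_smoothTransition_le_one _)
  have hlim := tendsto_integral_of_dominated_convergence (μ := volume.restrict (closure Ω))
    (F := fun (n : ℕ) q => Real.smoothTransition (n * g q ^ 2 - 1) * (g q * L q))
    (f := fun q => g q * L q) (fun q => ‖g q * L q‖) (fun n => (hθi n).aestronglyMeasurable)
    hint.norm (fun n => Filter.Eventually.of_forall fun q => by
      rw [norm_mul]
      exact mul_le_of_le_one_left (norm_nonneg _) (abs_smoothTransition_le_one _))
    (Filter.Eventually.of_forall fun q => tendsto_smoothTransition_mul (g q) (L q))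
  refine le_of_tendsto' hlim fun n => ?_
  have hassoc : ∀ q, Real.smoothTransition (n * g q ^ 2 - 1) * (g q * L q)
      = cutoffId n (g q) * L q := fun q => (mul_assoc _ _ _).symm
  have hi := hθi n
  simp only [hassoc] at hi ⊢
  -- `K` is the image of `{n g² ≥ 1}`: it is compact since `M` is, it lies in `Ω` because `f`
  -- vanishes at the points over `frontier Ω`, and the cut-off vanishes where `n g² ≤ 1`.
  refine integral_cutoff_mul_divergence_le h.smooth hgs n
    (K := projection x '' {p | 1 ≤ n * (graphDensity u (projection x p) * f p) ^ 2})
    ((isClosed_le continuous_const (continuous_const.mul (hcontg.pow 2))).isCompact.image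
      h.continuous_projection) ?_ ?_ hL hi
  · rintro _ ⟨p, hp, rfl⟩
    by_contra hq
    have : f p = 0 := hf0 p (h.mem_boundary p hq)
    simp only [Set.mem_ofPred_eq, this, mul_zero] at hp
    norm_num at hp
  · intro q hq
    by_cases hqr : ∃ p, projection x p = q
    · obtain ⟨p, rfl⟩ := hqr
      refine cutoffId_of_le ?_
      by_contra hlt
      refine hq ⟨p, ?_, rfl⟩
      rw [Set.mem_ofPred_eq, hF]
      exact (not_le.1 hlt).le
    · refine cutoffId_of_le ?_
      simp only [hgdef, hFdef]
      rw [Function.extend_apply' _ _ _ hqr]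
      simp

end Surface

/-! ### The calibration -/

/-- The projection to the horizontal plane as a linear map. -/
noncomputable def horizontalCLM : Space →L[ℝ] Plane :=
  LinearMap.toContinuousLinearMap
    { toFun := horizontal
      map_add' := fun v w => by ext k; fin_cases k <;> rfl
      map_smul' := fun c v => by ext k; fin_cases k <;> rfl }

theorem fderiv_comp_horizontal {G : Plane → ℝ} {q : Space}
    (hG : DifferentiableAt ℝ G (horizontal q)) (v : Space) :
    fderiv ℝ (fun q => G (horizontal q)) q v = fderiv ℝ G (horizontal q) (horizontal v) := by
  have h1 : HasFDerivAt horizontal horizontalCLM q := horizontalCLM.hasFDerivAt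
  have h2 : HasFDerivAt (fun q => G (horizontal q)) _ q := hG.hasFDerivAt.comp q h1
  rw [h2.fderiv]
  rfl

/-- The vertically extended unit normal of the graph of `u`, corrected by a vertical field so that
it is free of divergence. -/
noncomputable def calibration (u : Plane → ℝ) (s : ℝ) (q : Space) : Space :=
  s • (graphNormal u (horizontal q)
    + EuclideanSpace.single 2 (q 2 * graphCurvature u (horizontal q)))

theorem contDiff_calibration {u : Plane → ℝ} (hu : ContDiff ℝ ∞ u) (s : ℝ) :
    ContDiff ℝ ∞ (calibration u s) := by
  refine ContDiff.const_smul s (((contDiff_graphNormal hu).comp contDiff_horizontal).add ?_)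
  have h2 : ContDiff ℝ ∞ fun q : Space => q 2 * graphCurvature u (horizontal q) :=
    (EuclideanSpace.proj 2 : Space →L[ℝ] ℝ).contDiff.mul
      ((contDiff_graphCurvature hu).comp contDiff_horizontal)
  rw [contDiff_piLp]
  intro k
  by_cases hk : k = 2
  · subst hk
    simpa using h2
  · simp only [PiLp.single_apply, hk, if_false]
    exact contDiff_const

/-- The horizontal components contribute `-s div ν`. The vertical one depends on height only through
`s q₂ div ν`, which contributes the opposite. -/
theorem divergence_calibration {u : Plane → ℝ} (hu : ContDiff ℝ ∞ u) (s : ℝ) (q : Space) :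
    divergence (calibration u s) q = 0 := by
  have hcomp : ∀ k, fderiv ℝ (calibration u s) q (EuclideanSpace.single k 1) k
      = fderiv ℝ (fun q => calibration u s q k) q (EuclideanSpace.single k 1) := fun k => by
    have hd := ((contDiff_calibration hu s).differentiable (by simp) q).hasFDerivAt
    have : HasFDerivAt (fun q => calibration u s q k)
        ((EuclideanSpace.proj k : Space →L[ℝ] ℝ).comp (fderiv ℝ (calibration u s) q)) q :=
      (EuclideanSpace.proj k : Space →L[ℝ] ℝ).hasFDerivAt.comp q hd
    rw [this.fderiv]
    rfl
  have hh : ∀ k : Fin 2, horizontal (EuclideanSpace.single k.castSucc 1)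
      = EuclideanSpace.single k 1 := fun k => by
    ext j; fin_cases k <;> fin_cases j <;> simp [horizontal]
  have hh2 : horizontal (EuclideanSpace.single 2 1) = 0 := by
    ext j; fin_cases j <;> simp [horizontal]
  have hside : ∀ k : Fin 2, fderiv ℝ (fun q => calibration u s q k.castSucc) q
      (EuclideanSpace.single k.castSucc 1)
      = -(s * pderiv k (graphSlope u k) (horizontal q)) := fun k => by
    have hd : DifferentiableAt ℝ (graphSlope u k) (horizontal q) :=
      (contDiff_graphSlope hu k).differentiable (by simp) _
    have e : (fun q => calibration u s q k.castSucc)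
        = fun q => (fun q => -s * graphSlope u k q) (horizontal q) := by
      ext q; fin_cases k <;> simp [calibration, graphNormal]
    rw [e, fderiv_comp_horizontal (hd.const_mul _), hh, fderiv_const_mul hd]
    simp [pderiv]
  have htop : fderiv ℝ (fun q => calibration u s q 2) q (EuclideanSpace.single 2 1)
      = s * graphCurvature u (horizontal q) := by
    have e : (fun q => calibration u s q 2) = fun q => s * ((fun q => 1 / graphDensity u q)
        (horizontal q) + q 2 * graphCurvature u (horizontal q)) := by
      ext q; simp [calibration, graphNormal, mul_add]
    have hW : DifferentiableAt ℝ (fun q => 1 / graphDensity u q) (horizontal q) :=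
      (contDiff_inv_graphDensity hu).differentiable (by simp) _
    have hC : DifferentiableAt ℝ (graphCurvature u) (horizontal q) :=
      (contDiff_graphCurvature hu).differentiable (by simp) _
    have hhd : DifferentiableAt ℝ horizontal q := contDiff_horizontal.differentiable (by simp) _
    have hW' : DifferentiableAt ℝ (fun q => (fun q => 1 / graphDensity u q) (horizontal q)) q :=
      hW.comp q hhd
    have hC' : DifferentiableAt ℝ (fun q => graphCurvature u (horizontal q)) q := hC.comp q hhd
    have h2 : HasFDerivAt (fun q : Space => q 2) (EuclideanSpace.proj 2 : Space →L[ℝ] ℝ) q :=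
      (EuclideanSpace.proj 2 : Space →L[ℝ] ℝ).hasFDerivAt
    rw [e, fderiv_const_mul (hW'.fun_add (h2.differentiableAt.fun_mul hC')),
      fderiv_fun_add hW' (h2.differentiableAt.fun_mul hC'),
      fderiv_fun_mul h2.differentiableAt hC', h2.fderiv]
    simp only [smul_apply, add_apply, fderiv_comp_horizontal hW, fderiv_comp_horizontal hC, hh2,
      map_zero]
    simp
  have h0 := hside 0
  have h1 := hside 1
  rw [Fin.castSucc_zero] at h0
  rw [Fin.castSucc_one] at h1
  rw [divergence, Fin.sum_univ_three, hcomp, hcomp, hcomp, h0, h1, htop, graphCurvature,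
    Fin.sum_univ_two]
  ring

section Energy

variable {M : Type*} [TopologicalSpace M] [ChartedSpace (EuclideanHalfSpace 2) M]
  [IsManifold (𝓡∂ 2) ∞ M] [CompactSpace M] [MeasurableSpace M] [BorelSpace M]
  {x N : M → Space}

theorem integrable_areaMeasure (hx : ContMDiff (𝓡∂ 2) 𝓘(ℝ, Space) ∞ x) {f : M → ℝ}
    (hf : Continuous f) : Integrable f (areaMeasure x) :=
  have := isFiniteMeasure_areaMeasure hx
  hf.integrable_of_hasCompactSupport (HasCompactSupport.of_compactSpace f)

theorem IsOrientedImmersion.energy_eq (hx : IsOrientedImmersion x N) (a b : ℝ) :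
    energy a b x N
      = ∫ p, (1 + (a * radiusSq (x p) + b) * (x p 2 * N p 2)) ∂(areaMeasure x) := by
  have hc : ∀ {V : M → Space}, Continuous V → ∀ k : Fin 3, Continuous fun p => V p k :=
    fun hV k => (EuclideanSpace.proj k : Space →L[ℝ] ℝ).continuous.comp hV
  have hxc := hc hx.smooth.continuous
  have hNc := hc hx.smooth_normal.continuous
  have i0 := integrable_areaMeasure hx.smooth (continuous_const (y := (1 : ℝ)))
  have i1 : Integrable (fun p => radiusSq (x p) * x p 2 * N p 2) (areaMeasure x) :=
    integrable_areaMeasure hx.smooth (((((hxc 0).pow 2).add ((hxc 1).pow 2)).mul (hxc 2)).mul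
      (hNc 2))
  have i2 : Integrable (fun p => x p 2 * N p 2) (areaMeasure x) :=
    integrable_areaMeasure hx.smooth ((hxc 2).mul (hNc 2))
  rw [energy, ← integral_const_mul, ← integral_const_mul, ← integral_add i0 (i1.const_mul a),
    ← integral_add (i0.fun_add (i1.const_mul a)) (i2.const_mul b)]
  congr 1
  ext p
  ring

/-- For `w` a unit normal the second summand is the part of the energy density beyond area, so the
flux and the energy differ only in `⟨s ν̂, w⟩` against `1`, with `ν̂` the upward normal of the
graph. -/
theorem inner_calibration {u : Plane → ℝ} {s a b : ℝ} {v w : Space}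
    (hH : s * graphCurvature u (horizontal v)
      = a * (horizontal v 0 ^ 2 + horizontal v 1 ^ 2) + b) :
    inner ℝ (calibration u s v) w = inner ℝ (s • graphNormal u (horizontal v)) w
      + (a * radiusSq v + b) * (v 2 * w 2) := by
  have hr : horizontal v 0 ^ 2 + horizontal v 1 ^ 2 = radiusSq v := rfl
  rw [← hr, ← hH, calibration, smul_add, inner_add_left]
  congr 1
  rw [inner_space]
  simp
  ring

theorem IsOrientedImmersion.flux_calibration_le (hx : IsOrientedImmersion x N) {Ω : Set Plane}
    {u : Plane → ℝ} (hu : ContDiff ℝ ∞ u) {s a b : ℝ} (hs : s ^ 2 = 1)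
    (hH : ∀ q ∈ closure Ω, s * graphCurvature u q = a * (q 0 ^ 2 + q 1 ^ 2) + b)
    (hmem : ∀ p, horizontal (x p) ∈ closure Ω) :
    surfaceFlux x N (calibration u s) ≤ energy a b x N := by
  have hc : ∀ {V : M → Space}, Continuous V → ∀ k : Fin 3, Continuous fun p => V p k :=
    fun hV k => (EuclideanSpace.proj k : Space →L[ℝ] ℝ).continuous.comp hV
  have hxc := hc hx.smooth.continuous
  have hNc := hc hx.smooth_normal.continuous
  rw [surfaceFlux, hx.energy_eq]
  refine integral_mono (integrable_areaMeasure hx.smooth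
    (((contDiff_calibration hu s).continuous.comp hx.smooth.continuous).inner
      hx.smooth_normal.continuous)) (integrable_areaMeasure hx.smooth
    (continuous_const.add ((((continuous_const.mul (((hxc 0).pow 2).add ((hxc 1).pow 2))).add
      continuous_const)).mul ((hxc 2).mul (hNc 2))))) fun p => ?_
  simp only [inner_calibration (hH _ (hmem p))]
  -- Cauchy–Schwarz for two unit vectors; the other summands coincide.
  refine add_le_add_left ((real_inner_le_norm _ _).trans ?_) _
  rw [norm_smul, norm_graphNormal, hx.norm_normal, mul_one, mul_one, Real.norm_eq_abs]
  exact (sq_le_one_iff_abs_le_one s).1 hs.le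

theorem IsGraphSurface.flux_calibration {Ω : Set Plane} {u : Plane → ℝ} {s : ℝ}
    (h : IsGraphSurface Ω u s x N) {a b : ℝ}
    (hH : ∀ p, 2 * meanCurvature x N p = a * radiusSq (x p) + b) :
    surfaceFlux x N (calibration u s) = energy a b x N := by
  rw [surfaceFlux, h.oriented.energy_eq]
  congr 1
  ext p
  have hmem : horizontal (x p) ∈ closure Ω := by rw [← h.range_eq]; exact ⟨p, rfl⟩
  rw [inner_calibration (h.curvature_eq hH hmem)]
  congr 1
  have := h.normal_eq p
  rw [projection] at this
  rw [← this, real_inner_self_eq_norm_sq, h.oriented.norm_normal, one_pow]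

end Energy

end RotatingSurface

theorem mainTheorem8
    {M : Type*} [TopologicalSpace M] [ChartedSpace (EuclideanHalfSpace 2) M]
    [IsManifold (𝓡∂ 2) ∞ M] [T2Space M] [CompactSpace M] [MeasurableSpace M] [BorelSpace M]
    (a b : ℝ) (x N : M → RotatingSurface.Space) (Ω : Set RotatingSurface.Plane)
    (hΩ : IsOpen Ω) (hΩ' : IsConnected Ω)
    (hM : RotatingSurface.IsStationaryRotating a b x N)
    (hgraph : RotatingSurface.IsGraphOver Ω x) :
    RotatingSurface.IsStronglyStable a x N ∧
      ∀ {M' : Type*} [TopologicalSpace M'] [ChartedSpace (EuclideanHalfSpace 2) M']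
        [IsManifold (𝓡∂ 2) ∞ M'] [T2Space M'] [CompactSpace M'] [MeasurableSpace M']
        [BorelSpace M'] (y N' : M' → RotatingSurface.Space),
        RotatingSurface.IsOrientedImmersion y N' →
        Set.InjOn y ((𝓡∂ 2).boundary M') →
        y '' (𝓡∂ 2).boundary M' = x '' (𝓡∂ 2).boundary M →
        RotatingSurface.BoundOrientedChain x N y N' →
        (∀ p, RotatingSurface.horizontal (y p) ∈ closure Ω) →
        RotatingSurface.energy a b x N ≤ RotatingSurface.energy a b y N' := by
  obtain ⟨u, s, h⟩ := RotatingSurface.exists_isGraphSurface hΩ hΩ' hM.1 hgraph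
  refine ⟨h.isStronglyStable hΩ hM.2, ?_⟩
  intro M' _ _ _ _ _ _ _ y N' hy _ _ hW hmem
  obtain ⟨W, hW⟩ := hW
  have hflux := hW _ (RotatingSurface.contDiff_calibration h.smooth s)
  rw [W.flux_boundary_eq_zero (RotatingSurface.contDiff_calibration h.smooth s)
    (RotatingSurface.divergence_calibration h.smooth s), eq_comm, sub_eq_zero] at hflux
  -- The flux of the calibration through `M` is the energy of `M`, and it equals the flux through
  -- `M'`.
  rw [← h.flux_calibration hM.2, hflux]
  exact hy.flux_calibration_le h.smooth h.sign_sq (fun q hq => h.curvature_eq hM.2 hq) hmem
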